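/- Let $(\Omega,\mathcal F,\mathbf P)$ be a probability space and let $\{B(t)\}_{t\in\mathbf R}$ be a standard Brownian motion on the whole real line with $B(0)=0$. For $t\in\mathbf R$ let $\mathcal G_t$ be the $\sigma$-algebra generated by the increments $B(r)-B(q)$, $q\le r\le t$, and by the $\mathbf P$-null events (for $t\ge 0$ this is the augmentation of $\sigma(B(r): r\le t)$). Let $H\in(1/2,1)$, let $s<T$ be real numbers, and put $$c_H=\sqrt{\frac{2H\,\Gamma(3/2-H)}{\Gamma(1/2+H)\,\Gamma(2-2H)}},\qquad f(t,r)=(t-r)^{H-1/2}-(s-r)^{H-1/2},$$ $$G_H(\tau,s,T,g)=c_H\,(H-1/2)\int_\tau^T (t-\tau)^{H-3/2}g(t)\,dt,\qquad \mathcal D R_H(t)=c_H\int_{-\infty}^s f'_t(t,q)\,dB(q)\quad (s<t\le T),$$ the last integral being a Wiener integral and $\mathcal D R_H$ being taken in a jointly measurable version. Let $W_H(t)=c_H\int_s^t(t-r)^{H-1/2}dB(r)$. Let $\gamma(t)$, $t\in[s,T]$, be a (jointly measurable) real process such that $\gamma(t)$ is $\mathcal G_s$-measurable for every $t\in[s,T]$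 and $\mathbf E\int_s^T\gamma(t)^2\,dt<+\infty$. The integral $\int_s^T\gamma(t)\,dW_H(t)$ is by definition the Itô integral $\int_s^T G_H(\tau,s,T,\gamma)\,dB(\tau)$. Then: 1. almost surely, the integral defining $G_H(\tau,s,T,\gamma)$ converges for almost every $\tau\in[s,T]$, and the Itô integral $\int_s^T G_H(\tau,s,T,\gamma)\,dB(\tau)$ exists, is unique up to almost sure equality, and belongs to $L_1(\Omega,\mathcal G_T,\mathbf P)$; 2. the process $\mathcal D R_H$ on $(s,T]$ exists, and for each of its jointly measurable versions $\mathbf E\int_s^T|\gamma(t)\,\mathcal D R_H(t)|\,dt<+\infty$; the Lebesgue integral $\int_s^T\gamma(t)\,\mathcal D R_H(t)\,dt$ converges almost surely and belongs to $L_1(\Omega,\mathcal G_T,\mathbf P)$; 3. consequently the sum $$\int_s^T\gamma(t)\,\underline{d}B_H(t)=\int_s^T\gamma(t)\,dW_H(t)+\int_s^T\gamma(t)\,\mathcal D R_H(t)\,dt=\int_s^T G_H(\tau,s,T,\gamma)\,dB(\tau)+\int_s^T\gamma(t)\,\mathcal D R_H(t)\,dt$$ (the delayed integral of $\gamma$)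 is a well defined element of $L_1(\Omega,\mathcal G_T,\mathbf P)$: it exists and does not depend, up to almost sure equality, on the versions chosen. -/

import Mathlib

open MeasureTheory ProbabilityTheory Filter Topology

noncomputable section

/-- `B` is a standard Brownian motion indexed by the whole real line, with `B(0) = 0`. -/
structure IsTwoSidedBrownianMotion {Ω : Type*} [MeasurableSpace Ω]
    (B : ℝ → Ω → ℝ) (P : Measure Ω) : Prop where
  measurable : ∀ t, Measurable (B t)
  zero : ∀ᵐ ω ∂P, B 0 ω = 0
  indep_increments : HasIndepIncrements B P
  law_increment : ∀ q r : ℝ, q ≤ r →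
    HasLaw (fun ω ↦ B r ω - B q ω) (gaussianReal 0 (r - q).toNNReal) P
  continuous_paths : ∀ᵐ ω ∂P, Continuous (fun t ↦ B t ω)

/-- The σ-algebra `𝒢_t` of the past of `B` up to time `t`, augmented by the null events. It is
generated by the increments of `B` over subintervals of `(-∞, t]`; as `B(0) = 0` almost surely, for
`t ≥ 0` it is the augmentation of `σ(B(r) : r ≤ t)`. (For `t < 0` the variable `B(t) = B(t) - B(0)`
is an increment over the future of `t` and does not belong to the past.) -/
abbrev brownianPast {Ω : Type*} [MeasurableSpace Ω] (B : ℝ → Ω → ℝ) (P : Measure Ω) (t : ℝ) :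
    MeasurableSpace Ω :=
  (⨆ p : Set.Iic t × Set.Iic t,
      MeasurableSpace.comap (fun ω ↦ B p.2 ω - B p.1 ω) inferInstance) ⊔
    MeasurableSpace.generateFrom {N : Set Ω | MeasurableSet N ∧ P N = 0}

/-- A simple process, adapted to the family `𝒢`, with jump times in `S`:
`∑ₖ ξₖ 1_{(tₖ, tₖ₊₁]}` with `t₀ ≤ … ≤ tₙ` in `S` and `ξₖ` bounded and `𝒢_{tₖ}`-measurable. -/
structure SimpleAdaptedProcess {Ω : Type*} (𝒢 : ℝ → MeasurableSpace Ω) (S : Set ℝ) where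
  n : ℕ
  time : Fin (n + 1) → ℝ
  time_mono : Monotone time
  time_mem : ∀ k, time k ∈ S
  ξ : Fin n → Ω → ℝ
  ξ_measurable : ∀ k, Measurable[𝒢 (time k.castSucc)] (ξ k)
  ξ_bounded : ∃ C : ℝ, ∀ k ω, |ξ k ω| ≤ C

namespace SimpleAdaptedProcess

variable {Ω : Type*} {𝒢 : ℝ → MeasurableSpace Ω} {S : Set ℝ}

/-- The value at time `u`. -/
def val (φ : SimpleAdaptedProcess 𝒢 S) (u : ℝ) (ω : Ω) : ℝ :=
  ∑ k : Fin φ.n, (Set.Ioc (φ.time k.castSucc) (φ.time k.succ)).indicator (fun _ ↦ φ.ξ k ω) u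

/-- The elementary stochastic integral `∑ₖ ξₖ (B(tₖ₊₁) - B(tₖ))`. -/
def integral (φ : SimpleAdaptedProcess 𝒢 S) (B : ℝ → Ω → ℝ) (ω : Ω) : ℝ :=
  ∑ k : Fin φ.n, φ.ξ k ω * (B (φ.time k.succ) ω - B (φ.time k.castSucc) ω)

end SimpleAdaptedProcess

/-- `I` is (a version of) the Itô integral `∫_S f(u) dB(u)` over the interval `S`: the integrand `f`
is the limit in `L₂(S × Ω)` of simple adapted processes whose elementary integrals converge to `I`
in `L₂(Ω)`. For a non-random `f` this is the Wiener integral. -/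
def IsItoIntegral {Ω : Type*} [MeasurableSpace Ω] (B : ℝ → Ω → ℝ) (P : Measure Ω) (S : Set ℝ)
    (f : ℝ → Ω → ℝ) (I : Ω → ℝ) : Prop :=
  MemLp (fun p : ℝ × Ω ↦ f p.1 p.2) 2 ((volume.restrict S).prod P) ∧
  MemLp I 2 P ∧
  ∃ φ : ℕ → SimpleAdaptedProcess (brownianPast B P) S,
    Tendsto (fun n ↦ eLpNorm (fun p : ℝ × Ω ↦ f p.1 p.2 - (φ n).val p.1 p.2) 2
      ((volume.restrict S).prod P)) atTop (𝓝 0) ∧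
    Tendsto (fun n ↦ eLpNorm (fun ω ↦ I ω - (φ n).integral B ω) 2 P) atTop (𝓝 0)

/-- The normalising constant `c_H` of the moving average representation of fractional Brownian
motion with Hurst parameter `H`. -/
def fbmConst (H : ℝ) : ℝ :=
  Real.sqrt (2 * H * Real.Gamma (3 / 2 - H) / (Real.Gamma (1 / 2 + H) * Real.Gamma (2 - 2 * H)))

/-- `G_H(τ, s, T, g) = c_H (H - 1/2) ∫_τ^T (t - τ)^{H - 3/2} g(t) dt`
(which does not depend on `s`). -/
def fbmG (H T : ℝ) (g : ℝ → ℝ) (τ : ℝ) : ℝ :=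
  fbmConst H * (H - 1 / 2) * ∫ t in τ..T, (t - τ) ^ (H - 3 / 2) * g t

/-- `f(t, r) = (t - r)^{H - 1/2} - (s - r)^{H - 1/2}`, the kernel (up to the factor `c_H`) of
`R_H(t) = c_H ∫_{-∞}^s f(t, r) dB(r)`. -/
def fbmKernel (H s t r : ℝ) : ℝ :=
  (t - r) ^ (H - 1 / 2) - (s - r) ^ (H - 1 / 2)

/-- `I` is (a version of) `∫_s^T γ(t) dW_H(t)`, which is by definition the Itô integral
`∫_s^T G_H(τ, s, T, γ) dB(τ)`. -/
def IsIntegralDW {Ω : Type*} [MeasurableSpace Ω] (B : ℝ → Ω → ℝ) (P : Measure Ω) (H s T : ℝ)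
    (γ : ℝ → Ω → ℝ) (I : Ω → ℝ) : Prop :=
  IsItoIntegral B P (Set.Icc s T) (fun τ ω ↦ fbmG H T (fun t ↦ γ t ω) τ) I

/-- `D` is a jointly measurable version on `(s, T]` of the process
`𝒟R_H(t) = c_H ∫_{-∞}^s f'_t(t, q) dB(q)`. -/
def IsDR {Ω : Type*} [MeasurableSpace Ω] (B : ℝ → Ω → ℝ) (P : Measure Ω) (H s T : ℝ)
    (D : ℝ → Ω → ℝ) : Prop :=
  AEStronglyMeasurable (fun p : ℝ × Ω ↦ D p.1 p.2) ((volume.restrict (Set.Ioc s T)).prod P) ∧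
  ∀ t ∈ Set.Ioc s T, IsItoIntegral B P (Set.Iic s)
    (fun q _ ↦ fbmConst H * deriv (fun u ↦ fbmKernel H s u q) t) (D t)

/-- `J` is (a version of) the delayed integral of `γ` over `[s, T]`:
`J = ∫_s^T γ(t) dW_H(t) + ∫_s^T γ(t) 𝒟R_H(t) dt` almost surely. -/
def IsDelayedIntegral {Ω : Type*} [MeasurableSpace Ω] (B : ℝ → Ω → ℝ) (P : Measure Ω) (H s T : ℝ)
    (γ : ℝ → Ω → ℝ) (J : Ω → ℝ) : Prop :=
  ∃ (I : Ω → ℝ) (D : ℝ → Ω → ℝ), IsIntegralDW B P H s T γ I ∧ IsDR B P H s T D ∧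
    J =ᵐ[P] fun ω ↦ I ω + ∫ t in s..T, γ t ω * D t ω

/-- `X` belongs to `L₁(Ω, m, P)`, as a class of almost surely equal random variables. -/
def MemL1 {Ω : Type*} [MeasurableSpace Ω] (P : Measure Ω) (m : MeasurableSpace Ω)
    (X : Ω → ℝ) : Prop :=
  AEStronglyMeasurable[m] X P ∧ MemLp X 1 P

end

/-!
Everything rests on the independence of the past `𝒢_t` of a Brownian motion from its increments
after `t` (`indep_brownianPast_increment`). It makes the integral of a simple adapted process an
isometry from `L₂(dt ⊗ P)` to `L₂(P)`, so that Itô integrals are unique, and exist as soon as the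
integrand is an `L₂`-limit of simple adapted processes (`exists_isItoIntegral_of_tendsto`).

The integrands that occur here are known at the initial time: `G_H(τ, s, T, γ)` is
`𝒢_s`-measurable for each `τ`, and the kernel of `𝒟R_H` is deterministic. For such integrands no
general approximation theorem for progressively measurable processes is needed. The functions
`1_{(a, b]} ⊗ 1_A` with `A ∈ 𝒢_s` are simple adapted processes, and an element of `L₂(dt ⊗ P)` that
is orthogonal to all of them and whose sections are `𝒢_s`-measurable vanishes; as the sections of a
limit of such functions are `𝒢_s`-measurable too, the orthogonal projection onto their closed span
leaves such an integrand unchanged (`mem_closure_elementarySpan`, `exists_isItoIntegral`).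

For the first part of the delayed integral, `τ ↦ G_H(τ, s, T, γ)` is, path by path, a convolution
of `γ` with `u ↦ u^(H - 3/2)` on `(0, T - s]`. This kernel is integrable because `H > 1/2`, so
Young's inequality bounds the `L₂`-norm of `G_H` by that of `γ`, and Itô's isometry applies.

For the second part, the Wiener integral `𝒟R_H(t)` has second moment proportional to
`(t - s)^(2H - 2)`, which is integrable over `(s, T]` again because `H > 1/2`. Hence `𝒟R_H` belongs
to `L₂(dt ⊗ P)` and `γ 𝒟R_H` to `L₁(dt ⊗ P)`. A jointly measurable version exists since `𝒟R_H` is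
locally Lipschitz in mean square: it is an almost sure limit along dyadic approximations of the
time (`exists_measurable_version`). Two versions agree at each time almost surely, so by Fubini
almost surely at almost every time, and the integral of `γ 𝒟R_H` does not depend on the version.
-/

noncomputable section

/-! ### The past of a Brownian motion and its independence of future increments -/

/-- Finitely many reals are values of one non-decreasing sequence, which takes no other value. -/
lemma exists_monotone_enumeration (F : Finset ℝ) (hF : F.Nonempty) :
    ∃ t : ℕ → ℝ, Monotone t ∧ (∀ k, t k ∈ F) ∧ ∀ r ∈ F, ∃ k < F.card, t k = r := by
  have hpos : 0 < F.card := hF.card_pos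
  let g : ℕ → Fin F.card := fun k ↦ ⟨min k (F.card - 1), by omega⟩
  refine ⟨fun k ↦ F.orderEmbOfFin rfl (g k), ?_, fun k ↦ F.orderEmbOfFin_mem rfl _, ?_⟩
  · intro a b hab
    refine (F.orderEmbOfFin rfl).monotone ?_
    simp only [g, Fin.mk_le_mk]
    omega
  · intro r hr
    have : r ∈ Set.range (F.orderEmbOfFin rfl) := by
      rw [Finset.range_orderEmbOfFin]; exact hr
    obtain ⟨i, hi⟩ := this
    refine ⟨i, i.2, ?_⟩
    have : g i = i := by
      ext; simp only [g]; omega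
    simp only [this, hi]

/-- The increments before `u` are functions of the increments ending at `u`. -/
lemma comap_increment_le_comap_process {Ω : Type*} {B : ℝ → Ω → ℝ} {u : ℝ} (q r : Set.Iic u) :
    MeasurableSpace.comap (fun ω ↦ B r ω - B q ω) inferInstance ≤
      MeasurableSpace.comap (fun ω (i : Set.Iic u) ↦ B i ω - B u ω) MeasurableSpace.pi := by
  have : (fun ω ↦ B r ω - B q ω) = (fun x : Set.Iic u → ℝ ↦ x r - x q) ∘
      (fun ω (i : Set.Iic u) ↦ B i ω - B u ω) := by
    funext ω; simp
  rw [this, ← MeasurableSpace.comap_comp]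
  exact MeasurableSpace.comap_mono
    ((measurable_pi_apply r).sub (measurable_pi_apply q)).comap_le

section Past

variable {Ω : Type*} [MeasurableSpace Ω] {B : ℝ → Ω → ℝ} {P : Measure Ω}

lemma brownianPast_mono {u v : ℝ} (h : u ≤ v) : brownianPast B P u ≤ brownianPast B P v := by
  refine sup_le_sup_right (iSup_le fun p ↦ ?_) _
  exact le_iSup (fun p : Set.Iic v × Set.Iic v ↦
    MeasurableSpace.comap (fun ω ↦ B p.2 ω - B p.1 ω) inferInstance)
    (⟨p.1, p.1.2.trans h⟩, ⟨p.2, p.2.2.trans h⟩)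

lemma brownianPast_le (hB : IsTwoSidedBrownianMotion B P) (u : ℝ) :
    brownianPast B P u ≤ (inferInstance : MeasurableSpace Ω) := by
  refine sup_le (iSup_le fun p ↦ ?_) ?_
  · exact ((hB.measurable _).sub (hB.measurable _)).comap_le
  · exact MeasurableSpace.generateFrom_le fun N hN ↦ hN.1

lemma measurable_increment_brownianPast {q r u : ℝ} (hq : q ≤ u) (hr : r ≤ u) :
    Measurable[brownianPast B P u] (fun ω ↦ B r ω - B q ω) := by
  have h : MeasurableSpace.comap (fun ω ↦ B r ω - B q ω) inferInstance ≤ brownianPast B P u :=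
    (le_iSup (fun p : Set.Iic u × Set.Iic u ↦
      MeasurableSpace.comap (fun ω ↦ B p.2 ω - B p.1 ω) inferInstance)
      (⟨q, hq⟩, ⟨r, hr⟩)).trans le_sup_left
  exact (comap_measurable _).mono h le_rfl

lemma memLp_increment (hB : IsTwoSidedBrownianMotion B P) {u v : ℝ} (huv : u ≤ v) (p : NNReal) :
    MemLp (fun ω ↦ B v ω - B u ω) p P := by
  have h := hB.law_increment u v huv
  have h2 := memLp_id_gaussianReal (μ := 0) (v := (v - u).toNNReal) p
  rw [← h.map_eq] at h2
  exact (memLp_map_measure_iff aestronglyMeasurable_id h.aemeasurable).1 h2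

/-- Finitely many earlier increments, all ending at `u`, are sums of the increments over a common
subdivision, so they are independent of an increment starting at `u`. -/
lemma indepFun_finset_past (hB : IsTwoSidedBrownianMotion B P) {u v : ℝ} (huv : u ≤ v)
    (I : Finset (Set.Iic u)) :
    IndepFun (fun ω (i : I) ↦ B i ω - B u ω) (fun ω ↦ B v ω - B u ω) P := by
  classical
  let F : Finset ℝ := insert u (I.image (fun i : Set.Iic u ↦ (i : ℝ)))
  have hFu : ∀ x ∈ F, x ≤ u := by
    intro x hx
    rcases Finset.mem_insert.1 hx with rfl | hx
    · exact le_rfl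
    · obtain ⟨i, -, rfl⟩ := Finset.mem_image.1 hx
      exact i.2
  obtain ⟨t, ht, htF, hFt⟩ := exists_monotone_enumeration F ⟨u, Finset.mem_insert_self _ _⟩
  obtain ⟨N, -, hN⟩ := hFt u (Finset.mem_insert_self _ _)
  have hI : ∀ i : I, ∃ k, k ≤ N ∧ t k = i := by
    intro i
    obtain ⟨k, -, hk⟩ := hFt i (Finset.mem_insert_of_mem (Finset.mem_image_of_mem _ i.2))
    refine ⟨min k N, min_le_right _ _, ?_⟩
    rcases le_total k N with h | h
    · rw [min_eq_left h, hk]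
    · rw [min_eq_right h]
      exact le_antisymm (hk ▸ ht h) (hN ▸ i.1.2)
  choose κ hκN hκ using hI
  let t' : ℕ → ℝ := fun k ↦ if k ≤ N then t k else v
  have ht' : Monotone t' := by
    intro a b hab
    by_cases hb : b ≤ N
    · simp only [t', hb, hab.trans hb, if_true]; exact ht hab
    · by_cases ha : a ≤ N
      · simp only [t', hb, ha, if_true, if_false]; exact (hFu _ (htF a)).trans huv
      · simp only [t', hb, ha, if_false]; exact le_rfl
  have hle : ∀ k, k ≤ N → t' k = t k := fun k hk ↦ if_pos hk
  have hind := hB.indep_increments.nat ht'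
  have h2 := hind.indepFun_finset (Finset.range N) {N} (by simp)
    (fun i ↦ (hB.measurable _).sub (hB.measurable _))
  have hφ : Measurable (fun (x : Finset.range N → ℝ) (i : I) ↦
      -∑ j : Finset.range N, if κ i ≤ (j : ℕ) then x j else 0) := by
    refine measurable_pi_lambda _ fun i ↦ (Finset.measurable_sum _ fun j _ ↦ ?_).neg
    by_cases h : κ i ≤ (j : ℕ)
    · simp only [h, if_true]; exact measurable_pi_apply j
    · simp only [h, if_false]; exact measurable_const
  have hψ : Measurable (fun (y : ({N} : Finset ℕ) → ℝ) ↦ y ⟨N, Finset.mem_singleton_self N⟩) :=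
    measurable_pi_apply _
  have h3 := h2.comp hφ hψ
  convert h3 using 1
  · funext ω i
    have hs : ∀ m, m ≤ N → B (t' N) ω - B (t' m) ω =
        ∑ j ∈ Finset.range N, if m ≤ j then B (t' (j + 1)) ω - B (t' j) ω else 0 := by
      intro m hm
      rw [← Finset.sum_filter]
      have : (Finset.range N).filter (fun j ↦ m ≤ j) = Finset.Ico m N := by
        ext j; simp only [Finset.mem_filter, Finset.mem_range, Finset.mem_Ico]; tauto
      rw [this, Finset.sum_Ico_eq_sub _ hm, Finset.sum_range_sub (fun j ↦ B (t' j) ω),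
        Finset.sum_range_sub (fun j ↦ B (t' j) ω)]
      ring
    have := hs (κ i) (hκN i)
    rw [hle _ le_rfl, hle _ (hκN i), hN, hκ] at this
    simp only [Function.comp]
    rw [Finset.sum_coe_sort (Finset.range N)
      (fun j ↦ if κ i ≤ j then B (t' (j + 1)) ω - B (t' j) ω else 0), ← this]
    ring
  · funext ω
    simp only [Function.comp]
    rw [hle _ le_rfl, hN]
    simp [t']

variable [IsProbabilityMeasure P]

/-- Null events do not affect independence: modulo null events, the past is generated by the
process of increments ending at `u`. -/
lemma indep_brownianPast_increment (hB : IsTwoSidedBrownianMotion B P) {u v : ℝ} (huv : u ≤ v) :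
    Indep (brownianPast B P u)
      (MeasurableSpace.comap (fun ω ↦ B v ω - B u ω) inferInstance) P := by
  have h1 : IndepFun (fun ω (i : Set.Iic u) ↦ B i ω - B u ω) (fun ω ↦ B v ω - B u ω) P :=
    IndepFun.process_indepFun (fun i ↦ (hB.measurable _).sub (hB.measurable _))
      ((hB.measurable _).sub (hB.measurable _)) (indepFun_finset_past hB huv)
  have hle : brownianPast B P u ≤ eventuallyMeasurableSpace
      (MeasurableSpace.comap (fun ω (i : Set.Iic u) ↦ B i ω - B u ω) MeasurableSpace.pi) (ae P) := by
    refine sup_le (iSup_le fun p ↦ ?_) (MeasurableSpace.generateFrom_le fun N hN ↦ ?_)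
    · exact fun s hs ↦ ⟨s, comap_increment_le_comap_process p.1 p.2 s hs, EventuallyEq.refl _ _⟩
    · exact ⟨∅, @MeasurableSet.empty _ (_), ae_eq_empty.2 hN.2⟩
  rw [Indep_iff]
  intro t1 t2 ht1 ht2
  obtain ⟨t1', ht1', h⟩ := hle _ ht1
  have h1' := (Indep_iff _ _ _).1 (IndepFun_iff_Indep _ _ _ |>.1 h1) t1' t2 ht1' ht2
  rw [measure_congr h, ← h1']
  exact measure_congr (h.inter (ae_eq_refl t2))

lemma indepFun_past_increment (hB : IsTwoSidedBrownianMotion B P) {u v : ℝ} (huv : u ≤ v)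
    {X : Ω → ℝ} (hX : Measurable[brownianPast B P u] X) :
    IndepFun X (fun ω ↦ B v ω - B u ω) P :=
  (IndepFun_iff_Indep _ _ _).2
    (indep_of_indep_of_le_left (indep_brownianPast_increment hB huv) hX.comap_le)

lemma integral_past_mul_increment (hB : IsTwoSidedBrownianMotion B P) {u v : ℝ} (huv : u ≤ v)
    {X : Ω → ℝ} (hX : Measurable[brownianPast B P u] X) :
    ∫ ω, X ω * (B v ω - B u ω) ∂P = 0 := by
  have h := (indepFun_past_increment hB huv hX).integral_mul_eq_mul_integral
    (hX.mono (brownianPast_le hB u) le_rfl).aestronglyMeasurable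
    ((hB.measurable _).sub (hB.measurable _)).aestronglyMeasurable
  have h0 : ∫ ω, (B v ω - B u ω) ∂P = 0 := by
    rw [(hB.law_increment u v huv).integral_eq]
    simp
  rw [h0, mul_zero] at h
  exact h

lemma integral_past_mul_sq_increment (hB : IsTwoSidedBrownianMotion B P) {u v : ℝ} (huv : u ≤ v)
    {X : Ω → ℝ} (hX : Measurable[brownianPast B P u] X) :
    ∫ ω, X ω * (B v ω - B u ω) ^ 2 ∂P = (∫ ω, X ω ∂P) * (v - u) := by
  have hi := (indepFun_past_increment hB huv hX).comp (measurable_id) (measurable_id.pow_const 2)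
  have h := hi.integral_mul_eq_mul_integral
    (hX.mono (brownianPast_le hB u) le_rfl).aestronglyMeasurable
    (((hB.measurable _).sub (hB.measurable _)).pow_const 2).aestronglyMeasurable
  have h0 : ∫ ω, (B v ω - B u ω) ^ 2 ∂P = v - u := by
    have hL := hB.law_increment u v huv
    have hv := hL.variance_eq
    rw [variance_id_gaussianReal, variance_of_integral_eq_zero hL.aemeasurable
      (by rw [hL.integral_eq]; simp)] at hv
    rw [hv]
    simp [huv]
  have h1 : ∫ ω, X ω * (B v ω - B u ω) ^ 2 ∂P = (∫ ω, X ω ∂P) * ∫ ω, (B v ω - B u ω) ^ 2 ∂P := h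
  rw [h1, h0]

end Past

/-! ### Itô isometry for simple processes -/

section Isometry

lemma eLpNorm_two_eq_of_integral_sq_eq {α β : Type*} [MeasurableSpace α] [MeasurableSpace β]
    {μ : Measure α} {ν : Measure β} {f : α → ℝ} {g : β → ℝ} (hf : MemLp f 2 μ) (hg : MemLp g 2 ν)
    (h : ∫ x, f x ^ 2 ∂μ = ∫ y, g y ^ 2 ∂ν) : eLpNorm f 2 μ = eLpNorm g 2 ν := by
  rw [hf.eLpNorm_eq_integral_rpow_norm (by norm_num) (by norm_num),
    hg.eLpNorm_eq_integral_rpow_norm (by norm_num) (by norm_num)]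
  simpa using congrArg (fun x : ℝ ↦ ENNReal.ofReal (x ^ (2⁻¹ : ℝ))) h

lemma integral_sub_sq {α : Type*} [MeasurableSpace α] {μ : Measure α} {f g : α → ℝ}
    (hf : MemLp f 2 μ) (hg : MemLp g 2 μ) :
    ∫ x, (f x - g x) ^ 2 ∂μ = ∫ x, f x * f x ∂μ - 2 * ∫ x, f x * g x ∂μ + ∫ x, g x * g x ∂μ := by
  have iff : Integrable (fun x ↦ f x * f x) μ := hf.integrable_mul hf
  have ifg : Integrable (fun x ↦ f x * g x) μ := hf.integrable_mul hg
  have igg : Integrable (fun x ↦ g x * g x) μ := hg.integrable_mul hg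
  have e : ∀ x, (f x - g x) ^ 2 = f x * f x - 2 * (f x * g x) + g x * g x := fun x ↦ by ring
  rw [integral_congr_ae (ae_of_all _ e)]
  refine (integral_add (iff.sub (ifg.const_mul 2)) igg).trans ?_
  rw [integral_sub' iff (ifg.const_mul 2), integral_const_mul]

lemma integral_mul_sum_sum {α ι κ : Type*} [MeasurableSpace α] {μ : Measure α} [Fintype ι]
    [Fintype κ] {f : ι → α → ℝ} {g : κ → α → ℝ} (hf : ∀ i, MemLp (f i) 2 μ)
    (hg : ∀ j, MemLp (g j) 2 μ) :
    ∫ x, (∑ i, f i x) * (∑ j, g j x) ∂μ = ∑ i, ∑ j, ∫ x, f i x * g j x ∂μ := by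
  have h : ∀ i j, Integrable (fun x ↦ f i x * g j x) μ := fun i j ↦ (hf i).integrable_mul (hg j)
  simp only [Finset.sum_mul_sum]
  rw [integral_finsetSum _ fun i _ ↦ integrable_finsetSum _ fun j _ ↦ h i j]
  exact Finset.sum_congr rfl fun i _ ↦ integral_finsetSum _ fun j _ ↦ h i j

namespace SimpleAdaptedProcess

lemma coeff_bounded {Ω : Type*} {S : Set ℝ} {𝒢 : ℝ → MeasurableSpace Ω}
    (φ : SimpleAdaptedProcess 𝒢 S) (k : Fin φ.n) :
    ∃ C : ℝ, ∀ ω, |φ.ξ k ω| ≤ C :=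
  φ.ξ_bounded.imp fun _ h ω ↦ h k ω

lemma time_le {Ω : Type*} {S : Set ℝ} {𝒢 : ℝ → MeasurableSpace Ω}
    (φ : SimpleAdaptedProcess 𝒢 S) (k : Fin φ.n) :
    φ.time k.castSucc ≤ φ.time k.succ :=
  φ.time_mono (Fin.castSucc_le_succ k)

end SimpleAdaptedProcess

variable {Ω : Type*} [MeasurableSpace Ω] {B : ℝ → Ω → ℝ} {P : Measure Ω}

lemma integrable_bdd_mul_increments (hB : IsTwoSidedBrownianMotion B P) {a b c d : ℝ} (hab : a ≤ b)
    (hcd : c ≤ d) {X : Ω → ℝ} (hX : Measurable X) {C : ℝ} (hC : ∀ ω, |X ω| ≤ C) :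
    Integrable (fun ω ↦ X ω * ((B b ω - B a ω) * (B d ω - B c ω))) P := by
  have h1 : MemLp (fun ω ↦ B b ω - B a ω) 2 P := memLp_increment hB hab 2
  have h2 : MemLp (fun ω ↦ B d ω - B c ω) 2 P := memLp_increment hB hcd 2
  exact (h1.integrable_mul h2).bdd_mul (c := C) hX.aestronglyMeasurable
    (ae_of_all _ fun ω ↦ by simpa using hC ω)

namespace SimpleAdaptedProcess

variable {S : Set ℝ}

lemma measurable_coeff (hB : IsTwoSidedBrownianMotion B P)
    (φ : SimpleAdaptedProcess (brownianPast B P) S) (k : Fin φ.n) : Measurable (φ.ξ k) :=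
  (φ.ξ_measurable k).mono (brownianPast_le hB _) le_rfl

lemma memLp_summand (hB : IsTwoSidedBrownianMotion B P)
    (φ : SimpleAdaptedProcess (brownianPast B P) S) (k : Fin φ.n) :
    MemLp (fun ω ↦ φ.ξ k ω * (B (φ.time k.succ) ω - B (φ.time k.castSucc) ω)) 2 P := by
  obtain ⟨C, hC⟩ := φ.coeff_bounded k
  have h : MemLp (fun ω ↦ B (φ.time k.succ) ω - B (φ.time k.castSucc) ω) 2 P :=
    memLp_increment hB (φ.time_le k) 2
  refine MemLp.of_le_mul (c := C) h
    ((φ.measurable_coeff hB k).mul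
      ((hB.measurable _).sub (hB.measurable _))).aestronglyMeasurable (ae_of_all _ fun ω ↦ ?_)
  rw [norm_mul]
  exact mul_le_mul_of_nonneg_right (hC ω) (norm_nonneg _)

lemma memLp_integral (hB : IsTwoSidedBrownianMotion B P)
    (φ : SimpleAdaptedProcess (brownianPast B P) S) :
    MemLp (φ.integral B) 2 P :=
  memLp_finsetSum _ fun k _ ↦ φ.memLp_summand hB k

lemma measurable_integral_brownianPast {T : ℝ} (hST : S ⊆ Set.Iic T)
    (φ : SimpleAdaptedProcess (brownianPast B P) S) :
    Measurable[brownianPast B P T] (φ.integral B) := by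
  refine Finset.measurable_sum _ fun k _ ↦ ?_
  exact ((φ.ξ_measurable k).mono (brownianPast_mono (hST (φ.time_mem _))) le_rfl).mul
    (measurable_increment_brownianPast (hST (φ.time_mem _)) (hST (φ.time_mem _)))

end SimpleAdaptedProcess

variable [IsProbabilityMeasure P]

/-- The covariance of two elementary integrals. The product of the two increments is split at the
endpoints of the common interval; only the square of the common increment has non-zero mean. -/
lemma integral_elementary_mul (hB : IsTwoSidedBrownianMotion B P) {a b c d : ℝ} (hab : a ≤ b)
    (hcd : c ≤ d) {ξ η : Ω → ℝ} (hξ : Measurable[brownianPast B P a] ξ)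
    (hη : Measurable[brownianPast B P c] η) (hξb : ∃ C : ℝ, ∀ ω, |ξ ω| ≤ C)
    (hηb : ∃ C : ℝ, ∀ ω, |η ω| ≤ C) :
    ∫ ω, (ξ ω * (B b ω - B a ω)) * (η ω * (B d ω - B c ω)) ∂P =
      max (min b d - max a c) 0 * ∫ ω, ξ ω * η ω ∂P := by
  wlog hac : a ≤ c generalizing a b c d ξ η
  · have := this hcd hab hη hξ hηb hξb (le_of_not_ge hac)
    rw [min_comm, max_comm a c]
    simp only [mul_comm (ξ _ * _), mul_comm (ξ _) (η _)]
    exact this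
  rw [max_eq_right hac]
  obtain ⟨C, hC⟩ := hξb
  obtain ⟨D, hD⟩ := hηb
  have hξ' : Measurable[brownianPast B P c] ξ := hξ.mono (brownianPast_mono hac) le_rfl
  have hX : Measurable[brownianPast B P c] (fun ω ↦ ξ ω * η ω) := hξ'.mul hη
  have hXb : ∀ ω, |ξ ω * η ω| ≤ C * D := fun ω ↦ by
    rw [abs_mul]
    exact mul_le_mul (hC ω) (hD ω) (abs_nonneg _) ((abs_nonneg _).trans (hC ω))
  have hXm : Measurable (fun ω ↦ ξ ω * η ω) := hX.mono (brownianPast_le hB c) le_rfl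
  rcases le_total b c with hbc | hcb
  · have h0 : max (min b d - c) 0 = 0 :=
      max_eq_right (by linarith [min_le_left b d])
    rw [h0, zero_mul]
    have hXB : Measurable[brownianPast B P c] (fun ω ↦ ξ ω * η ω * (B b ω - B a ω)) :=
      hX.mul (measurable_increment_brownianPast hac hbc)
    rw [← integral_past_mul_increment hB hcd hXB]
    exact integral_congr_ae (ae_of_all _ fun ω ↦ by ring)
  · have hac' := hac
    set e := min b d with he
    set m := max b d with hm
    have hce : c ≤ e := le_min hcb hcd
    have hem : e ≤ m := (min_le_left _ _).trans (le_max_left _ _)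
    have hXY : ∀ ω, (B b ω - B c ω) * (B d ω - B c ω) = (B e ω - B c ω) * (B m ω - B c ω) := by
      intro ω
      rcases le_total b d with h | h
      · rw [he, hm, min_eq_left h, max_eq_right h]
      · rw [he, hm, min_eq_right h, max_eq_left h, mul_comm]
    have hsplit : ∀ ω, (ξ ω * (B b ω - B a ω)) * (η ω * (B d ω - B c ω)) =
        (ξ ω * η ω) * ((B c ω - B a ω) * (B d ω - B c ω)) +
        (ξ ω * η ω) * ((B e ω - B c ω) * (B e ω - B c ω)) +
        (ξ ω * η ω) * ((B e ω - B c ω) * (B m ω - B e ω)) := by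
      intro ω
      linear_combination (ξ ω * η ω) * hXY ω
    have i1 := integrable_bdd_mul_increments hB hac hcd hXm hXb
    have i2 := integrable_bdd_mul_increments hB hce hce hXm hXb
    have i3 := integrable_bdd_mul_increments hB hce hem hXm hXb
    have z1 : ∫ ω, (ξ ω * η ω) * ((B c ω - B a ω) * (B d ω - B c ω)) ∂P = 0 := by
      have hXB : Measurable[brownianPast B P c] (fun ω ↦ ξ ω * η ω * (B c ω - B a ω)) :=
        hX.mul (measurable_increment_brownianPast hac le_rfl)
      rw [← integral_past_mul_increment hB hcd hXB]
      exact integral_congr_ae (ae_of_all _ fun ω ↦ by ring)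
    have z2 : ∫ ω, (ξ ω * η ω) * ((B e ω - B c ω) * (B e ω - B c ω)) ∂P =
        (∫ ω, ξ ω * η ω ∂P) * (e - c) := by
      rw [← integral_past_mul_sq_increment hB hce hX]
      exact integral_congr_ae (ae_of_all _ fun ω ↦ by ring)
    have z3 : ∫ ω, (ξ ω * η ω) * ((B e ω - B c ω) * (B m ω - B e ω)) ∂P = 0 := by
      have hXB : Measurable[brownianPast B P e] (fun ω ↦ ξ ω * η ω * (B e ω - B c ω)) :=
        (hX.mono (brownianPast_mono hce) le_rfl).mul
          (measurable_increment_brownianPast hce le_rfl)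
      rw [← integral_past_mul_increment hB hem hXB]
      exact integral_congr_ae (ae_of_all _ fun ω ↦ by ring)
    rw [integral_congr_ae (ae_of_all _ hsplit)]
    refine (integral_add (i1.add i2) i3).trans ?_
    rw [integral_add' i1 i2, z1, z2, z3, max_eq_left (sub_nonneg.2 hce)]
    ring

/-- The elementary process `ξ 1_{(a, b]}` written as a product. -/
lemma indicator_const_eq_mul (I : Set ℝ) (x u : ℝ) :
    I.indicator (fun _ ↦ x) u = I.indicator (fun _ ↦ (1 : ℝ)) u * x := by
  by_cases h : u ∈ I <;> simp [h]

lemma memLp_elementary {S : Set ℝ} (a b : ℝ) {ξ : Ω → ℝ} (hξ : Measurable ξ)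
    (hξb : ∃ C : ℝ, ∀ ω, |ξ ω| ≤ C) :
    MemLp (fun p : ℝ × Ω ↦ (Set.Ioc a b).indicator (fun _ ↦ ξ p.2) p.1) 2
      ((volume.restrict S).prod P) := by
  obtain ⟨C, hC⟩ := hξb
  have h1 : Measurable ((Set.Ioc a b).indicator (fun _ : ℝ ↦ (1 : ℝ))) :=
    measurable_const.indicator measurableSet_Ioc
  have he : (fun p : ℝ × Ω ↦ (Set.Ioc a b).indicator (fun _ ↦ ξ p.2) p.1) =
      fun p : ℝ × Ω ↦ (Set.Ioc a b).indicator (fun _ ↦ (1 : ℝ)) p.1 * ξ p.2 :=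
    funext fun p ↦ indicator_const_eq_mul _ _ _
  rw [he]
  have hm : Measurable fun p : ℝ × Ω ↦ (Set.Ioc a b).indicator (fun _ ↦ (1 : ℝ)) p.1 * ξ p.2 :=
    (h1.comp measurable_fst).mul (hξ.comp measurable_snd)
  refine (memLp_two_iff_integrable_sq hm.aestronglyMeasurable).2 ?_
  simp only [mul_pow]
  refine Integrable.mul_prod (f := fun t ↦ (Set.Ioc a b).indicator (fun _ : ℝ ↦ (1 : ℝ)) t ^ 2)
    (g := fun ω ↦ ξ ω ^ 2) ?_ ?_
  · have : (fun t ↦ (Set.Ioc a b).indicator (fun _ : ℝ ↦ (1 : ℝ)) t ^ 2) =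
        (Set.Ioc a b).indicator (fun _ : ℝ ↦ (1 : ℝ)) := by
      funext t
      by_cases h : t ∈ Set.Ioc a b <;> simp [h]
    rw [this, integrable_indicator_iff measurableSet_Ioc]
    exact integrableOn_const (by
      refine ((Measure.restrict_apply_le _ _).trans_lt ?_).ne
      simp)
  · refine Integrable.of_bound (hξ.pow_const 2).aestronglyMeasurable (C ^ 2) (ae_of_all _ fun ω ↦ ?_)
    rw [Real.norm_eq_abs, abs_pow]
    exact pow_le_pow_left₀ (abs_nonneg _) (hC ω) 2

lemma integral_elementary_val_mul {S : Set ℝ} (hS : S.OrdConnected) {a b c d : ℝ} (ha : a ∈ S)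
    (hb : b ∈ S) (ξ η : Ω → ℝ) :
    ∫ p : ℝ × Ω, (Set.Ioc a b).indicator (fun _ ↦ ξ p.2) p.1 *
        (Set.Ioc c d).indicator (fun _ ↦ η p.2) p.1 ∂((volume.restrict S).prod P) =
      max (min b d - max a c) 0 * ∫ ω, ξ ω * η ω ∂P := by
  have h : ∀ p : ℝ × Ω, (Set.Ioc a b).indicator (fun _ ↦ ξ p.2) p.1 *
        (Set.Ioc c d).indicator (fun _ ↦ η p.2) p.1 =
      (Set.Ioc (max a c) (min b d)).indicator (fun _ ↦ (1 : ℝ)) p.1 * (ξ p.2 * η p.2) := by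
    intro p
    rw [indicator_const_eq_mul _ (ξ _), indicator_const_eq_mul _ (η _)]
    have : (Set.Ioc (max a c) (min b d)) = Set.Ioc a b ∩ Set.Ioc c d := Set.Ioc_inter_Ioc.symm
    rw [this]
    by_cases h1 : p.1 ∈ Set.Ioc a b <;> by_cases h2 : p.1 ∈ Set.Ioc c d <;> simp [h1, h2]
  simp only [h]
  rw [integral_prod_mul (fun t ↦ (Set.Ioc (max a c) (min b d)).indicator (fun _ ↦ (1 : ℝ)) t)
    (fun ω ↦ ξ ω * η ω), integral_indicator_const _ measurableSet_Ioc]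
  have hsub : Set.Ioc (max a c) (min b d) ⊆ S := fun x hx ↦
    hS.out ha hb ⟨(le_max_left _ _).trans hx.1.le, hx.2.trans (min_le_left _ _)⟩
  rw [measureReal_restrict_apply measurableSet_Ioc, Set.inter_eq_left.2 hsub,
    Real.volume_real_Ioc, smul_eq_mul, mul_one]

namespace SimpleAdaptedProcess

variable {S : Set ℝ}

lemma memLp_val (hB : IsTwoSidedBrownianMotion B P)
    (φ : SimpleAdaptedProcess (brownianPast B P) S) :
    MemLp (fun p : ℝ × Ω ↦ φ.val p.1 p.2) 2 ((volume.restrict S).prod P) :=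
  memLp_finsetSum _ fun k _ ↦ memLp_elementary _ _ (φ.measurable_coeff hB k) (φ.coeff_bounded k)

lemma integral_val_mul_val (hB : IsTwoSidedBrownianMotion B P) (hS : S.OrdConnected)
    (φ ψ : SimpleAdaptedProcess (brownianPast B P) S) :
    ∫ p : ℝ × Ω, φ.val p.1 p.2 * ψ.val p.1 p.2 ∂((volume.restrict S).prod P) =
      ∫ ω, φ.integral B ω * ψ.integral B ω ∂P := by
  have hV : ∀ χ : SimpleAdaptedProcess (brownianPast B P) S, ∀ k, MemLp (fun p : ℝ × Ω ↦
      (Set.Ioc (χ.time k.castSucc) (χ.time k.succ)).indicator (fun _ ↦ χ.ξ k p.2) p.1) 2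
      ((volume.restrict S).prod P) := fun χ k ↦
    memLp_elementary _ _ (χ.measurable_coeff hB k) (χ.coeff_bounded k)
  refine (integral_mul_sum_sum (hV φ) (hV ψ)).trans (Eq.trans ?_
    (integral_mul_sum_sum (φ.memLp_summand hB) (ψ.memLp_summand hB)).symm)
  refine Finset.sum_congr rfl fun k _ ↦ Finset.sum_congr rfl fun l _ ↦ ?_
  rw [integral_elementary_val_mul hS (φ.time_mem _) (φ.time_mem _),
    integral_elementary_mul hB (φ.time_le k) (ψ.time_le l) (φ.ξ_measurable k) (ψ.ξ_measurable l)
      (φ.coeff_bounded k) (ψ.coeff_bounded l)]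

/-- The Itô isometry for the difference of two simple processes. -/
lemma eLpNorm_val_sub_val (hB : IsTwoSidedBrownianMotion B P) (hS : S.OrdConnected)
    (φ ψ : SimpleAdaptedProcess (brownianPast B P) S) :
    eLpNorm (fun p : ℝ × Ω ↦ φ.val p.1 p.2 - ψ.val p.1 p.2) 2 ((volume.restrict S).prod P) =
      eLpNorm (fun ω ↦ φ.integral B ω - ψ.integral B ω) 2 P := by
  refine eLpNorm_two_eq_of_integral_sq_eq ((φ.memLp_val hB).sub (ψ.memLp_val hB))
    ((φ.memLp_integral hB).sub (ψ.memLp_integral hB)) ?_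
  rw [integral_sub_sq (φ.memLp_val hB) (ψ.memLp_val hB),
    integral_sub_sq (φ.memLp_integral hB) (ψ.memLp_integral hB)]
  simp only [integral_val_mul_val hB hS]

end SimpleAdaptedProcess

end Isometry

/-! ### Sums of elementary processes -/

section Simple

/-- A sum of finitely many elementary processes `ξ 1_{(a, b]}` is a simple process: all the
endpoints are arranged in one sequence, which subdivides each of the intervals. -/
lemma exists_simpleAdaptedProcess_sum {Ω ι : Type*} [Fintype ι] {𝒢 : ℝ → MeasurableSpace Ω}
    (h𝒢 : Monotone 𝒢) {S : Set ℝ} (hS : S.Nonempty) (a b : ι → ℝ) (ha : ∀ i, a i ∈ S)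
    (hb : ∀ i, b i ∈ S) (ξ : ι → Ω → ℝ) (hξ : ∀ i, Measurable[𝒢 (a i)] (ξ i))
    (hξb : ∀ i, ∃ C : ℝ, ∀ ω, |ξ i ω| ≤ C) :
    ∃ φ : SimpleAdaptedProcess 𝒢 S, ∀ u ω, φ.val u ω =
      ∑ i, (Set.Ioc (a i) (b i)).indicator (fun _ ↦ ξ i ω) u := by
  classical
  obtain ⟨x₀, hx₀⟩ := hS
  let F : Finset ℝ := insert x₀ (Finset.univ.image a ∪ Finset.univ.image b)
  have hFS : ∀ x ∈ F, x ∈ S := by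
    intro x hx
    simp only [F, Finset.mem_insert, Finset.mem_union, Finset.mem_image, Finset.mem_univ,
      true_and] at hx
    rcases hx with rfl | ⟨i, rfl⟩ | ⟨i, rfl⟩
    exacts [hx₀, ha i, hb i]
  have haF : ∀ i, a i ∈ F := fun i ↦ by simp [F]
  have hbF : ∀ i, b i ∈ F := fun i ↦ by simp [F]
  obtain ⟨t, ht, htF, hFt⟩ := exists_monotone_enumeration F ⟨x₀, Finset.mem_insert_self _ _⟩
  choose C hC using hξb
  refine ⟨{ n := F.card
            time := fun k ↦ t k
            time_mono := fun k l hkl ↦ ht hkl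
            time_mem := fun k ↦ hFS _ (htF _)
            ξ := fun k ω ↦ ∑ i, if a i ≤ t k ∧ t (k + 1) ≤ b i then ξ i ω else 0
            ξ_measurable := fun k ↦ ?_
            ξ_bounded := ⟨∑ i, |C i|, fun k ω ↦ ?_⟩ }, fun u ω ↦ ?_⟩
  · refine Finset.measurable_sum _ fun i _ ↦ ?_
    by_cases h : a i ≤ t k ∧ t (k + 1) ≤ b i
    · simp only [h, and_self, if_true]
      exact (hξ i).mono (h𝒢 h.1) le_rfl
    · simp only [h, if_false]
      exact measurable_const
  · refine (Finset.abs_sum_le_sum_abs _ _).trans (Finset.sum_le_sum fun i _ ↦ ?_)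
    split_ifs
    · exact (hC i ω).trans (le_abs_self _)
    · simp
  · simp only [SimpleAdaptedProcess.val, Fin.val_castSucc, Fin.val_succ]
    have h1 : ∀ k : ℕ, (Set.Ioc (t k) (t (k + 1))).indicator
        (fun _ ↦ ∑ i, if a i ≤ t k ∧ t (k + 1) ≤ b i then ξ i ω else 0) u =
        ∑ i, if u ∈ Set.Ioc (t k) (t (k + 1)) ∧ a i ≤ t k ∧ t (k + 1) ≤ b i
          then ξ i ω else 0 := by
      intro k
      by_cases h : u ∈ Set.Ioc (t k) (t (k + 1)) <;> simp [h]
    simp only [h1]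
    rw [Finset.sum_comm]
    refine Finset.sum_congr rfl fun i _ ↦ ?_
    obtain ⟨p, -, hp⟩ := hFt _ (haF i)
    obtain ⟨q, hqF, hq⟩ := hFt _ (hbF i)
    by_cases hu : u ∈ Set.Ioc (a i) (b i)
    · rw [Set.indicator_of_mem hu]
      have hex : ∃ k, u ≤ t k := ⟨q, hq ▸ hu.2⟩
      have hmin : ∀ j, j < Nat.find hex → t j < u := fun j hj ↦ not_le.1 (Nat.find_min hex hj)
      have hpos : p < Nat.find hex := by
        by_contra h
        exact absurd ((Nat.find_spec hex).trans (ht (not_lt.1 h))) (not_le.2 (hp ▸ hu.1))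
      obtain ⟨k, hk⟩ : ∃ k, Nat.find hex = k + 1 := ⟨Nat.find hex - 1, by omega⟩
      have hpk : p ≤ k := by rw [hk] at hpos; omega
      have hkq : k + 1 ≤ q := hk ▸ Nat.find_min' hex (hq ▸ hu.2)
      have hku : u ≤ t (k + 1) := hk ▸ Nat.find_spec hex
      have hkl : t k < u := hmin k (by omega)
      rw [Finset.sum_eq_single (⟨k, by omega⟩ : Fin F.card)]
      · exact if_pos ⟨⟨hkl, hku⟩, hp ▸ ht hpk, hq ▸ ht hkq⟩
      · intro j _ hj
        refine if_neg fun h ↦ hj (Fin.ext ?_)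
        have h2 : ¬ (j : ℕ) < k := fun hlt ↦
          absurd (h.1.2.trans (ht hlt)) (not_le.2 hkl)
        have h3 : ¬ k < (j : ℕ) := fun hlt ↦
          absurd (hku.trans (ht hlt)) (not_le.2 h.1.1)
        exact le_antisymm (not_lt.1 h3) (not_lt.1 h2)
      · intro h
        exact absurd (Finset.mem_univ _) h
    · rw [Set.indicator_of_notMem hu]
      refine Finset.sum_eq_zero fun k _ ↦ if_neg fun h ↦ hu ?_
      exact ⟨h.2.1.trans_lt h.1.1, h.1.2.trans h.2.2⟩

end Simple

/-! ### The Itô integral: isometry, uniqueness, adaptedness, and construction from approximations -/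

section Ito

/-- An almost everywhere limit of functions measurable with respect to a sub-σ-algebra. -/
lemma aestronglyMeasurable_of_ae_tendsto_of_le {α : Type*} {m m₀ : MeasurableSpace α}
    {μ : Measure α} {f : ℕ → α → ℝ} {g : α → ℝ} (hf : ∀ n, AEStronglyMeasurable[m] (f n) μ)
    (h : ∀ᵐ x ∂μ, Tendsto (fun n ↦ f n x) atTop (𝓝 (g x))) : AEStronglyMeasurable[m] g μ := by
  refine ⟨fun x ↦ limsup (fun n ↦ (hf n).mk _ x) atTop, Measurable.stronglyMeasurable
    (Measurable.limsup fun n ↦ (hf n).stronglyMeasurable_mk.measurable), ?_⟩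
  filter_upwards [h, ae_all_iff.2 fun n ↦ (hf n).ae_eq_mk] with x hx hx'
  simp only [hx'] at hx
  exact hx.limsup_eq.symm

lemma eLpNorm_sub_le_add_add {γ : Type*} [MeasurableSpace γ] {ρ : Measure γ} {w x y z : γ → ℝ}
    (hw : AEStronglyMeasurable w ρ) (hx : AEStronglyMeasurable x ρ)
    (hy : AEStronglyMeasurable y ρ) (hz : AEStronglyMeasurable z ρ) :
    eLpNorm (fun i ↦ w i - z i) 2 ρ ≤ eLpNorm (fun i ↦ w i - x i) 2 ρ +
      eLpNorm (fun i ↦ x i - y i) 2 ρ + eLpNorm (fun i ↦ z i - y i) 2 ρ := by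
  have e : (fun i ↦ w i - z i) = ((fun i ↦ w i - x i) + fun i ↦ x i - y i) - fun i ↦ z i - y i := by
    funext i; simp
  rw [e]
  refine (eLpNorm_sub_le ((hw.sub hx).add (hx.sub hy)) (hz.sub hy) (by norm_num)).trans ?_
  exact add_le_add (eLpNorm_add_le (hw.sub hx) (hx.sub hy) (by norm_num)) le_rfl

/-- An isometry passes to limits, in terms of `L₂` seminorms of differences. -/
lemma eLpNorm_sub_le_of_tendsto {α β : Type*} [MeasurableSpace α] [MeasurableSpace β]
    {μ : Measure α} {ν : Measure β} {u u' : α → ℝ} {v v' : β → ℝ} {a b : ℕ → α → ℝ}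
    {c d : ℕ → β → ℝ} (hu : AEStronglyMeasurable u μ) (hu' : AEStronglyMeasurable u' μ)
    (hv : AEStronglyMeasurable v ν) (hv' : AEStronglyMeasurable v' ν)
    (ha : ∀ n, AEStronglyMeasurable (a n) μ) (hb : ∀ n, AEStronglyMeasurable (b n) μ)
    (hc : ∀ n, AEStronglyMeasurable (c n) ν) (hd : ∀ n, AEStronglyMeasurable (d n) ν)
    (h : ∀ n, eLpNorm (fun x ↦ a n x - b n x) 2 μ = eLpNorm (fun x ↦ c n x - d n x) 2 ν)
    (hua : Tendsto (fun n ↦ eLpNorm (fun x ↦ u x - a n x) 2 μ) atTop (𝓝 0))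
    (hub : Tendsto (fun n ↦ eLpNorm (fun x ↦ u' x - b n x) 2 μ) atTop (𝓝 0))
    (hvc : Tendsto (fun n ↦ eLpNorm (fun x ↦ v x - c n x) 2 ν) atTop (𝓝 0))
    (hvd : Tendsto (fun n ↦ eLpNorm (fun x ↦ v' x - d n x) 2 ν) atTop (𝓝 0)) :
    eLpNorm (fun x ↦ u x - u' x) 2 μ ≤ eLpNorm (fun x ↦ v x - v' x) 2 ν := by
  have hle : ∀ n, eLpNorm (fun x ↦ u x - u' x) 2 μ ≤
      eLpNorm (fun x ↦ u x - a n x) 2 μ + (eLpNorm (fun x ↦ v x - c n x) 2 ν +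
        eLpNorm (fun x ↦ v x - v' x) 2 ν + eLpNorm (fun x ↦ v' x - d n x) 2 ν) +
        eLpNorm (fun x ↦ u' x - b n x) 2 μ := by
    intro n
    refine (eLpNorm_sub_le_add_add hu (ha n) (hb n) hu').trans ?_
    rw [h n]
    refine add_le_add (add_le_add le_rfl ?_) le_rfl
    refine (eLpNorm_sub_le_add_add (hc n) hv hv' (hd n)).trans_eq ?_
    have e1 : eLpNorm (fun x ↦ c n x - v x) 2 ν = eLpNorm (fun x ↦ v x - c n x) 2 ν :=
      eLpNorm_sub_comm _ _ _ _
    have e2 : eLpNorm (fun x ↦ d n x - v' x) 2 ν = eLpNorm (fun x ↦ v' x - d n x) 2 ν :=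
      eLpNorm_sub_comm _ _ _ _
    rw [e1, e2]
  have ht := (hua.add ((hvc.add_const (eLpNorm (fun x ↦ v x - v' x) 2 ν)).add hvd)).add hub
  simp only [zero_add, add_zero] at ht
  exact ge_of_tendsto' ht hle

variable {Ω : Type*} [MeasurableSpace Ω] {B : ℝ → Ω → ℝ} {P : Measure Ω}
  {S : Set ℝ} {f g : ℝ → Ω → ℝ} {I J : Ω → ℝ}

lemma IsItoIntegral.congr (h : IsItoIntegral B P S f I) (hIJ : I =ᵐ[P] J) :
    IsItoIntegral B P S f J := by
  obtain ⟨hf, hI, φ, hφ, hφI⟩ := h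
  refine ⟨hf, hI.ae_eq hIJ, φ, hφ, hφI.congr fun n ↦ eLpNorm_congr_ae ?_⟩
  filter_upwards [hIJ] with ω hω
  rw [hω]

lemma isItoIntegral_zero (hS : S.Nonempty) : IsItoIntegral B P S (fun _ _ ↦ 0) (fun _ ↦ 0) := by
  obtain ⟨x, hx⟩ := hS
  let φ : SimpleAdaptedProcess (brownianPast B P) S :=
    { n := 0, time := fun _ ↦ x, time_mono := monotone_const, time_mem := fun _ ↦ hx
      ξ := fun _ _ ↦ 0, ξ_measurable := fun _ ↦ measurable_const, ξ_bounded := ⟨0, by simp⟩ }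
  refine ⟨MemLp.zero', MemLp.zero', fun _ ↦ φ, ?_, ?_⟩
  · simp [φ, SimpleAdaptedProcess.val]
  · simp [φ, SimpleAdaptedProcess.integral]

lemma IsItoIntegral.aestronglyMeasurable_past {T : ℝ}
    (hB : IsTwoSidedBrownianMotion B P) (hST : S ⊆ Set.Iic T) (hI : IsItoIntegral B P S f I) :
    AEStronglyMeasurable[brownianPast B P T] I P := by
  obtain ⟨-, hI, φ, -, hφI⟩ := hI
  have hφI' : Tendsto (fun n ↦ eLpNorm ((φ n).integral B - I) 2 P) atTop (𝓝 0) := by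
    refine hφI.congr fun n ↦ ?_
    exact eLpNorm_sub_comm _ _ _ _
  obtain ⟨ns, -, hns⟩ := (tendstoInMeasure_of_tendsto_eLpNorm (by norm_num)
    (fun n ↦ ((φ n).memLp_integral hB).1) hI.1 hφI').exists_seq_tendsto_ae
  exact aestronglyMeasurable_of_ae_tendsto_of_le (f := fun k ↦ (φ (ns k)).integral B)
    (fun k ↦ ((φ (ns k)).measurable_integral_brownianPast hST).aestronglyMeasurable) hns

variable [IsProbabilityMeasure P]

lemma IsItoIntegral.eLpNorm_sub (hB : IsTwoSidedBrownianMotion B P) (hS : S.OrdConnected)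
    (hf : IsItoIntegral B P S f I) (hg : IsItoIntegral B P S g J) :
    eLpNorm (fun ω ↦ I ω - J ω) 2 P =
      eLpNorm (fun p : ℝ × Ω ↦ f p.1 p.2 - g p.1 p.2) 2 ((volume.restrict S).prod P) := by
  obtain ⟨hf, hI, φ, hφ, hφI⟩ := hf
  obtain ⟨hg, hJ, ψ, hψ, hψJ⟩ := hg
  have mV := fun χ : ℕ → SimpleAdaptedProcess (brownianPast B P) S ↦ fun n ↦
    ((χ n).memLp_val hB).1
  have mI := fun χ : ℕ → SimpleAdaptedProcess (brownianPast B P) S ↦ fun n ↦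
    ((χ n).memLp_integral hB).1
  exact le_antisymm
    (eLpNorm_sub_le_of_tendsto hI.1 hJ.1 hf.1 hg.1 (mI φ) (mI ψ) (mV φ) (mV ψ)
      (fun n ↦ ((φ n).eLpNorm_val_sub_val hB hS (ψ n)).symm) hφI hψJ hφ hψ)
    (eLpNorm_sub_le_of_tendsto hf.1 hg.1 hI.1 hJ.1 (mV φ) (mV ψ) (mI φ) (mI ψ)
      (fun n ↦ (φ n).eLpNorm_val_sub_val hB hS (ψ n)) hφ hψ hφI hψJ)

lemma IsItoIntegral.ae_eq (hB : IsTwoSidedBrownianMotion B P) (hS : S.OrdConnected)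
    (hI : IsItoIntegral B P S f I) (hJ : IsItoIntegral B P S f J) : I =ᵐ[P] J := by
  have h := hI.eLpNorm_sub hB hS hJ
  simp only [sub_self, eLpNorm_zero'] at h
  have h0 := (eLpNorm_eq_zero_iff (hI.2.1.1.sub hJ.2.1.1) (by norm_num)).1 h
  filter_upwards [h0] with ω hω
  exact sub_eq_zero.1 hω

/-- The Itô isometry. -/
lemma IsItoIntegral.eLpNorm_eq (hB : IsTwoSidedBrownianMotion B P) (hS : S.OrdConnected)
    (hS' : S.Nonempty) (hI : IsItoIntegral B P S f I) :
    eLpNorm I 2 P = eLpNorm (fun p : ℝ × Ω ↦ f p.1 p.2) 2 ((volume.restrict S).prod P) := by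
  simpa using hI.eLpNorm_sub hB hS (isItoIntegral_zero hS')

/-- An integrand which is an `L₂` limit of simple processes has an Itô integral. -/
lemma exists_isItoIntegral_of_tendsto (hB : IsTwoSidedBrownianMotion B P) (hS : S.OrdConnected)
    (hf : MemLp (fun p : ℝ × Ω ↦ f p.1 p.2) 2 ((volume.restrict S).prod P))
    (φ : ℕ → SimpleAdaptedProcess (brownianPast B P) S)
    (hφ : Tendsto (fun n ↦ eLpNorm (fun p : ℝ × Ω ↦ f p.1 p.2 - (φ n).val p.1 p.2) 2
      ((volume.restrict S).prod P)) atTop (𝓝 0)) :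
    ∃ I, IsItoIntegral B P S f I := by
  let V : ℕ → Lp ℝ 2 ((volume.restrict S).prod P) := fun n ↦ ((φ n).memLp_val hB).toLp _
  let Y : ℕ → Lp ℝ 2 P := fun n ↦ ((φ n).memLp_integral hB).toLp _
  have hV : Tendsto V atTop (𝓝 (hf.toLp _)) := by
    refine (Lp.tendsto_Lp_iff_tendsto_eLpNorm'' _ _ _ _).2 (hφ.congr fun n ↦ ?_)
    exact eLpNorm_sub_comm _ _ _ _
  have hdist : ∀ m n, dist (Y m) (Y n) = dist (V m) (V n) := by
    intro m n
    simp only [dist_edist, Y, V, Lp.edist_toLp_toLp]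
    exact congrArg _ ((φ m).eLpNorm_val_sub_val hB hS (φ n)).symm
  have hY : CauchySeq Y := by
    have := hV.cauchySeq
    rw [Metric.cauchySeq_iff] at this ⊢
    simpa only [hdist] using this
  obtain ⟨y, hy⟩ := cauchySeq_tendsto_of_complete hY
  refine ⟨y, hf, Lp.memLp y, φ, hφ, ?_⟩
  have hy' := (Lp.tendsto_Lp_iff_tendsto_eLpNorm' _ _).1 hy
  refine hy'.congr fun n ↦ ?_
  rw [eLpNorm_sub_comm]
  refine eLpNorm_congr_ae ?_
  filter_upwards [((φ n).memLp_integral hB).coeFn_toLp] with ω hω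
  simp only [Pi.sub_apply, Y]
  rw [hω]

end Ito

/-! ### Families of random variables measurable with respect to a fixed σ-algebra -/

section Sections

/-- Against `m`-measurable variables, the indicator of an event may be replaced by a bounded
`m`-measurable variable, a version of its conditional probability. -/
lemma exists_measurable_setIntegral_eq {Ω : Type*} {m m₀ : MeasurableSpace Ω} (hm : m ≤ m₀)
    (P : Measure Ω) [IsProbabilityMeasure P] {A : Set Ω} (hA : MeasurableSet A) :
    ∃ ζ : Ω → ℝ, Measurable[m] ζ ∧ (∀ ω, |ζ ω| ≤ 1) ∧ ∀ X : Ω → ℝ, Integrable X P →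
      AEStronglyMeasurable[m] X P → ∫ ω in A, X ω ∂P = ∫ ω, X ω * ζ ω ∂P := by
  let Z : Ω → ℝ := P[A.indicator (fun _ ↦ (1 : ℝ)) | m]
  have hZm : Measurable[m] Z := stronglyMeasurable_condExp.measurable
  have hint : Integrable (A.indicator (fun _ ↦ (1 : ℝ))) P :=
    (integrable_const 1).indicator hA
  have hZ0 : 0 ≤ᵐ[P] Z := condExp_nonneg (ae_of_all _ fun ω ↦ by
    by_cases h : ω ∈ A <;> simp [h])
  have hZ1 : Z ≤ᵐ[P] fun _ ↦ 1 := by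
    have h := condExp_mono (m := m) hint (integrable_const (1 : ℝ)) (ae_of_all P fun ω ↦ by
      by_cases h : ω ∈ A <;> simp [h])
    rwa [condExp_const hm] at h
  refine ⟨fun ω ↦ max (min (Z ω) 1) (-1), (hZm.min measurable_const).max measurable_const,
    fun ω ↦ abs_le.2 ⟨le_max_right _ _, max_le (min_le_right _ _) (by norm_num)⟩,
    fun X hX hXm ↦ ?_⟩
  have hXA : X * A.indicator (fun _ ↦ (1 : ℝ)) = A.indicator X := by
    funext ω
    by_cases h : ω ∈ A <;> simp [h]
  have h1 : P[X * A.indicator (fun _ ↦ (1 : ℝ)) | m] =ᵐ[P] X * Z :=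
    condExp_mul_of_aestronglyMeasurable_left hXm (hXA ▸ hX.indicator hA) hint
  rw [← integral_indicator hA, ← hXA, ← integral_condExp hm]
  refine integral_congr_ae (h1.trans ?_)
  filter_upwards [hZ0, hZ1] with ω h0 h1
  simp only [Pi.zero_apply] at h0
  simp only [Pi.mul_apply]
  rw [min_eq_left h1, max_eq_left (by linarith)]

variable {α Ω : Type*} [MeasurableSpace α] {m m₀ : MeasurableSpace Ω} {μ : Measure α}
  {P : Measure Ω} [IsProbabilityMeasure P]

/-- Measurability of sections with respect to `m` is preserved by convergence in `L₂`. -/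
lemma section_aestronglyMeasurable_of_tendsto {F : ℕ → Lp ℝ 2 (μ.prod P)} {G : Lp ℝ 2 (μ.prod P)}
    (hF : ∀ n, ∀ᵐ t ∂μ, AEStronglyMeasurable[m] (fun ω ↦ F n (t, ω)) P)
    (h : Tendsto F atTop (𝓝 G)) :
    ∀ᵐ t ∂μ, AEStronglyMeasurable[m] (fun ω ↦ G (t, ω)) P := by
  have h' := (Lp.tendsto_Lp_iff_tendsto_eLpNorm' _ _).1 h
  obtain ⟨ns, -, hns⟩ := (tendstoInMeasure_of_tendsto_eLpNorm (by norm_num)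
    (fun n ↦ (Lp.memLp (F n)).1) (Lp.memLp G).1 h').exists_seq_tendsto_ae
  filter_upwards [Measure.ae_ae_of_ae_prod hns, ae_all_iff.2 hF] with t ht htF
  exact aestronglyMeasurable_of_ae_tendsto_of_le (fun n ↦ htF (ns n)) ht

variable [SFinite μ]

/-- A Lebesgue integral of `m`-measurable variables is `m`-measurable modulo null sets, even if the
family is only jointly measurable with respect to the larger σ-algebra. -/
lemma aestronglyMeasurable_integral_of_section (hm : m ≤ m₀) {h : α × Ω → ℝ}
    (hh : Integrable h (μ.prod P))
    (hsec : ∀ᵐ t ∂μ, AEStronglyMeasurable[m] (fun ω ↦ h (t, ω)) P) :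
    AEStronglyMeasurable[m] (fun ω ↦ ∫ t, h (t, ω) ∂μ) P := by
  have hX : Integrable (fun ω ↦ ∫ t, h (t, ω) ∂μ) P := hh.integral_prod_right
  refine ⟨P[fun ω ↦ ∫ t, h (t, ω) ∂μ | m], stronglyMeasurable_condExp, ?_⟩
  refine Integrable.ae_eq_of_forall_setIntegral_eq _ _ hX integrable_condExp fun A hA _ ↦ ?_
  obtain ⟨ζ, hζm, hζb, hζ⟩ := exists_measurable_setIntegral_eq hm P hA
  have hζm₀ : Measurable ζ := hζm.mono hm le_rfl
  have hhζ : Integrable (fun p : α × Ω ↦ h p * ζ p.2) (μ.prod P) := by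
    refine (hh.bdd_mul (c := 1) (f := fun p : α × Ω ↦ ζ p.2)
      (hζm₀.comp measurable_snd).aestronglyMeasurable (ae_of_all _ fun p ↦ hζb p.2)).congr ?_
    exact ae_of_all _ fun p ↦ mul_comm _ _
  have hhA : Integrable h (μ.prod (P.restrict A)) := by
    have := hh.restrict (s := Set.univ ×ˢ A)
    rwa [← Measure.prod_restrict, Measure.restrict_univ] at this
  -- test the integral against the event `A`, and move the integral over `t` outside
  have e1 : ∫ ω in A, ∫ t, h (t, ω) ∂μ ∂P = ∫ ω, (∫ t, h (t, ω) ∂μ) * ζ ω ∂P := by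
    rw [← integral_prod_symm h hhA, integral_prod h hhA]
    simp only [← integral_mul_const]
    rw [← integral_prod_symm _ hhζ, integral_prod _ hhζ]
    refine integral_congr_ae ?_
    filter_upwards [hsec, hh.prod_right_ae] with t ht hti
    exact hζ _ hti ht
  rw [e1, hζ _ integrable_condExp stronglyMeasurable_condExp.aestronglyMeasurable]
  have h2 := condExp_mul_of_aestronglyMeasurable_right (m := m) (μ := P)
    (f := fun ω ↦ ∫ t, h (t, ω) ∂μ) (g := ζ) hζm.stronglyMeasurable.aestronglyMeasurable
    (by
      refine (hX.bdd_mul (c := 1) hζm₀.aestronglyMeasurable (ae_of_all _ hζb)).congr ?_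
      exact ae_of_all _ fun p ↦ mul_comm _ _) hX
  rw [← integral_condExp hm (f := fun ω ↦ (∫ t, h (t, ω) ∂μ) * ζ ω)]
  exact integral_congr_ae h2

end Sections

/-! ### Functions on a strip determined by their integrals over rectangles -/

section Rectangles

variable {Ω : Type*} [MeasurableSpace Ω] {P : Measure Ω}

/-- An integrable function on a strip vanishes if its integrals over all rectangles vanish. -/
lemma ae_eq_zero_of_forall_rectangle {μ : Measure ℝ} {g : ℝ × Ω → ℝ}
    (hg : Integrable g (μ.prod P))
    (h : ∀ a b : ℝ, ∀ A : Set Ω, MeasurableSet A →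
      ∫ p in Set.Ioc a b ×ˢ A, g p ∂(μ.prod P) = 0) (hu : ∫ p, g p ∂(μ.prod P) = 0) :
    g =ᵐ[μ.prod P] 0 := by
  have hv : (μ.prod P).withDensityᵥ g = (μ.prod P).withDensityᵥ 0 := by
    refine VectorMeasure.ext_of_generateFrom
      (Set.image2 (· ×ˢ ·) {I : Set ℝ | ∃ a b : ℝ, a < b ∧ Set.Ioc a b = I}
        {A : Set Ω | MeasurableSet A}) ?_ ?_ ?_ ?_
    · rintro _ ⟨I, ⟨a, b, -, rfl⟩, A, hA, rfl⟩
      rw [withDensityᵥ_apply hg (measurableSet_Ioc.prod hA), withDensityᵥ_zero, h a b A hA]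
      simp
    · refine (generateFrom_eq_prod ?_ MeasurableSpace.generateFrom_measurableSet ?_
        isCountablySpanning_measurableSet).symm
      · rw [BorelSpace.measurable_eq (α := ℝ), borel_eq_generateFrom_Ioc]
      · refine ⟨fun n : ℕ ↦ Set.Ioc (-(n + 1) : ℝ) (n + 1),
          fun n ↦ ⟨_, _, by linarith [n.cast_nonneg (α := ℝ)], rfl⟩, ?_⟩
        refine Set.eq_univ_of_forall fun x ↦ Set.mem_iUnion.2 ?_
        obtain ⟨n, hn⟩ := exists_nat_gt |x|
        exact ⟨n, by linarith [neg_abs_le x], by linarith [le_abs_self x]⟩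
    · exact IsPiSystem.prod (isPiSystem_Ioc id id) MeasurableSpace.isPiSystem_measurableSet
    · rw [withDensityᵥ_apply hg MeasurableSet.univ, withDensityᵥ_zero]
      simpa using hu
  exact hg.ae_eq_of_withDensityᵥ_eq (integrable_zero _ _ _) hv

end Rectangles

/-! ### Density of simple processes -/

section Density

variable {Ω : Type*} {𝒢₀ mΩ : MeasurableSpace Ω} {B : ℝ → Ω → ℝ} {P : Measure Ω}
  {S : Set ℝ}

/-- The span in `L₂(S × Ω)` of the elementary processes `ξ 1_{(a, b]}` with endpoints in `S` and a
bounded `𝒢₀`-measurable coefficient `ξ`. -/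
def elementarySpan (𝒢₀ : MeasurableSpace Ω) {mΩ : MeasurableSpace Ω} (P : Measure Ω) (S : Set ℝ) :
    Submodule ℝ (Lp ℝ 2 ((volume.restrict S).prod P)) :=
  Submodule.span ℝ {F | ∃ a ∈ S, ∃ b ∈ S, ∃ ξ : Ω → ℝ, Measurable[𝒢₀] ξ ∧
    (∃ C : ℝ, ∀ ω, |ξ ω| ≤ C) ∧ F =ᵐ[(volume.restrict S).prod P]
      fun p ↦ (Set.Ioc a b).indicator (fun _ ↦ ξ p.2) p.1}

lemma exists_simpleAdaptedProcess_of_mem_span (hS : S.Nonempty)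
    (h𝒢₀ : ∀ u ∈ S, 𝒢₀ ≤ brownianPast B P u) {F : Lp ℝ 2 ((volume.restrict S).prod P)}
    (hF : F ∈ elementarySpan 𝒢₀ P S) :
    ∃ φ : SimpleAdaptedProcess (brownianPast B P) S,
      F =ᵐ[(volume.restrict S).prod P] fun p ↦ φ.val p.1 p.2 := by
  have hmono : Monotone (brownianPast B P) := fun _ _ h ↦ brownianPast_mono h
  induction hF using Submodule.span_induction with
  | mem F hF =>
    obtain ⟨a, ha, b, hb, ξ, hξ, hξb, hF⟩ := hF
    obtain ⟨φ, hφ⟩ := exists_simpleAdaptedProcess_sum hmono hS (fun _ : Unit ↦ a) (fun _ ↦ b)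
      (fun _ ↦ ha) (fun _ ↦ hb) (fun _ ↦ ξ) (fun _ ↦ hξ.mono (h𝒢₀ a ha) le_rfl) (fun _ ↦ hξb)
    exact ⟨φ, hF.trans (ae_of_all _ fun p ↦ by simp [hφ])⟩
  | zero =>
    obtain ⟨φ, hφ⟩ := exists_simpleAdaptedProcess_sum hmono hS (fun i : Empty ↦ i.elim)
      (fun i ↦ i.elim) (fun i ↦ i.elim) (fun i ↦ i.elim) (fun i ↦ i.elim) (fun i ↦ i.elim)
      (fun i ↦ i.elim)
    refine ⟨φ, (Lp.coeFn_zero ℝ 2 _).trans (ae_of_all _ fun p ↦ by simp [hφ])⟩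
  | add F G _ _ hF hG =>
    obtain ⟨φ, hφ⟩ := hF
    obtain ⟨ψ, hψ⟩ := hG
    obtain ⟨χ, hχ⟩ := exists_simpleAdaptedProcess_sum hmono hS
      (Sum.elim (fun k ↦ φ.time k.castSucc) (fun k ↦ ψ.time k.castSucc))
      (Sum.elim (fun k ↦ φ.time k.succ) (fun k ↦ ψ.time k.succ))
      (by rintro (k | k); exacts [φ.time_mem _, ψ.time_mem _])
      (by rintro (k | k); exacts [φ.time_mem _, ψ.time_mem _])
      (Sum.elim φ.ξ ψ.ξ)
      (by rintro (k | k); exacts [φ.ξ_measurable k, ψ.ξ_measurable k])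
      (by rintro (k | k); exacts [φ.coeff_bounded k, ψ.coeff_bounded k])
    refine ⟨χ, (Lp.coeFn_add F G).trans ?_⟩
    filter_upwards [hφ, hψ] with p h1 h2
    rw [hχ]
    simp [h1, h2, SimpleAdaptedProcess.val]
  | smul c F _ hF =>
    obtain ⟨φ, hφ⟩ := hF
    obtain ⟨χ, hχ⟩ := exists_simpleAdaptedProcess_sum hmono hS
      (fun k ↦ φ.time k.castSucc) (fun k ↦ φ.time k.succ) (fun k ↦ φ.time_mem _)
      (fun k ↦ φ.time_mem _) (fun k ω ↦ c * φ.ξ k ω) (fun k ↦ (φ.ξ_measurable k).const_mul c)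
      (fun k ↦ by
        obtain ⟨C, hC⟩ := φ.coeff_bounded k
        refine ⟨|c| * C, fun ω ↦ ?_⟩
        rw [abs_mul]
        exact mul_le_mul_of_nonneg_left (hC ω) (abs_nonneg c))
    refine ⟨χ, (Lp.coeFn_smul c F).trans ?_⟩
    filter_upwards [hφ] with p h1
    rw [hχ]
    simp [h1, SimpleAdaptedProcess.val, Finset.mul_sum, Set.indicator_apply]

variable [IsProbabilityMeasure P]

lemma section_aestronglyMeasurable_of_mem_span {F : Lp ℝ 2 ((volume.restrict S).prod P)}
    (hF : F ∈ elementarySpan 𝒢₀ P S) :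
    ∀ᵐ t ∂(volume.restrict S), AEStronglyMeasurable[𝒢₀] (fun ω ↦ F (t, ω)) P := by
  induction hF using Submodule.span_induction with
  | mem F hF =>
    obtain ⟨a, ha, b, hb, ξ, hξ, hξb, hF⟩ := hF
    filter_upwards [Measure.ae_ae_of_ae_prod hF] with t ht
    refine AEStronglyMeasurable.congr ?_ (Filter.EventuallyEq.symm ht)
    by_cases h : t ∈ Set.Ioc a b
    · simp only [h, Set.indicator_of_mem]
      exact hξ.stronglyMeasurable.aestronglyMeasurable
    · simp only [h, not_false_eq_true, Set.indicator_of_notMem]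
      exact stronglyMeasurable_const.aestronglyMeasurable
  | zero =>
    filter_upwards [Measure.ae_ae_of_ae_prod (Lp.coeFn_zero ℝ 2 ((volume.restrict S).prod P))]
      with t ht
    exact (stronglyMeasurable_const (b := (0 : ℝ))).aestronglyMeasurable.congr
      (Filter.EventuallyEq.symm ht)
  | add F G _ _ hF hG =>
    filter_upwards [Measure.ae_ae_of_ae_prod (Lp.coeFn_add F G), hF, hG] with t ht h1 h2
    exact (h1.add h2).congr (Filter.EventuallyEq.symm ht)
  | smul c F _ hF =>
    filter_upwards [Measure.ae_ae_of_ae_prod (Lp.coeFn_smul c F), hF] with t ht h1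
    exact (h1.const_smul c).congr (Filter.EventuallyEq.symm ht)

lemma section_aestronglyMeasurable_of_mem_closure {F : Lp ℝ 2 ((volume.restrict S).prod P)}
    (hF : F ∈ (elementarySpan 𝒢₀ P S).topologicalClosure) :
    ∀ᵐ t ∂(volume.restrict S), AEStronglyMeasurable[𝒢₀] (fun ω ↦ F (t, ω)) P := by
  obtain ⟨x, hx, hxF⟩ := mem_closure_iff_seq_limit.1 hF
  exact section_aestronglyMeasurable_of_tendsto
    (fun n ↦ section_aestronglyMeasurable_of_mem_span (hx n)) hxF

lemma isFiniteMeasure_strip (c d : ℝ) :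
    IsFiniteMeasure (((volume.restrict S).prod P).restrict (Set.Ioc c d ×ˢ Set.univ)) := by
  rw [← Measure.prod_restrict, Measure.restrict_restrict measurableSet_Ioc, Measure.restrict_univ]
  have : IsFiniteMeasure (volume.restrict (Set.Ioc c d ∩ S)) :=
    ⟨by
      rw [Measure.restrict_apply_univ]
      exact (measure_mono Set.inter_subset_left).trans_lt (by simp)⟩
  infer_instance

/-- A function orthogonal to the elementary processes, all of whose sections are
`𝒢₀`-measurable, has vanishing integrals over all rectangles. -/
lemma setIntegral_rectangle_eq_zero (hm : 𝒢₀ ≤ mΩ)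
    {G : Lp ℝ 2 ((volume.restrict S).prod P)} (hG : G ∈ (elementarySpan 𝒢₀ P S)ᗮ)
    (hsec : ∀ᵐ t ∂(volume.restrict S), AEStronglyMeasurable[𝒢₀] (fun ω ↦ G (t, ω)) P)
    {c d : ℝ} (hc : c ∈ S) (hd : d ∈ S) {A : Set Ω} (hA : MeasurableSet A) :
    ∫ p in Set.Ioc c d ×ˢ A, G p ∂((volume.restrict S).prod P) = 0 := by
  obtain ⟨ζ, hζm, hζb, hζ⟩ := exists_measurable_setIntegral_eq hm P hA
  have hζm₀ : Measurable ζ := hζm.mono hm le_rfl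
  have hfin := isFiniteMeasure_strip (P := P) (S := S) c d
  have hGi : IntegrableOn G (Set.Ioc c d ×ˢ Set.univ) ((volume.restrict S).prod P) :=
    ((Lp.memLp G).restrict _).integrable (by norm_num)
  have hGζ : IntegrableOn (fun p ↦ G p * ζ p.2) (Set.Ioc c d ×ˢ Set.univ)
      ((volume.restrict S).prod P) := by
    refine (hGi.bdd_mul (c := 1) (f := fun p : ℝ × Ω ↦ ζ p.2)
      (hζm₀.comp measurable_snd).aestronglyMeasurable (ae_of_all _ fun p ↦ hζb p.2)).congr ?_
    exact ae_of_all _ fun p ↦ mul_comm _ _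
  have he := memLp_elementary (P := P) (S := S) c d hζm₀ ⟨1, hζb⟩
  have horth := (Submodule.mem_orthogonal _ _).1 hG (he.toLp _)
    (Submodule.subset_span ⟨c, hc, d, hd, ζ, hζm, ⟨1, hζb⟩, he.coeFn_toLp⟩)
  rw [L2.inner_def] at horth
  have h1 : ∫ p in Set.Ioc c d ×ˢ Set.univ, G p * ζ p.2 ∂((volume.restrict S).prod P) = 0 := by
    rw [← horth, ← integral_indicator (measurableSet_Ioc.prod MeasurableSet.univ)]
    refine integral_congr_ae ?_
    filter_upwards [he.coeFn_toLp] with p hp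
    rw [hp]
    by_cases h : p.1 ∈ Set.Ioc c d
    · simp [Set.indicator, Set.mem_prod, h.1, h.2]
    · have h' : ¬ (c < p.1 ∧ p.1 ≤ d) := h
      simp [Set.indicator, Set.mem_prod, h']
  rw [setIntegral_prod _ (hGi.mono_set (Set.prod_mono_right (Set.subset_univ A))), ← h1,
    setIntegral_prod _ hGζ]
  refine integral_congr_ae ?_
  have hGi' : Integrable G (((volume.restrict S).restrict (Set.Ioc c d)).prod P) := by
    have := hGi
    rw [IntegrableOn, ← Measure.prod_restrict, Measure.restrict_univ] at this
    exact this
  filter_upwards [ae_restrict_of_ae hsec, hGi'.prod_right_ae] with t ht hti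
  rw [Measure.restrict_univ]
  exact hζ _ hti ht

/-- `S` is exhausted, up to a null set, by countably many intervals with endpoints in `S`. -/
def IsExhaustedByIoc (S : Set ℝ) : Prop :=
  ∃ a b : ℕ → ℝ, (∀ n, a n ∈ S) ∧ (∀ n, b n ∈ S) ∧
    ∀ᵐ t ∂(volume.restrict S), ∃ n, t ∈ Set.Ioc (a n) (b n)

/-- The elementary processes with `𝒢₀`-measurable coefficients are dense among the processes in
`L₂(S × Ω)` with `𝒢₀`-measurable sections. -/
lemma mem_closure_elementarySpan (hS : S.OrdConnected) (hSe : IsExhaustedByIoc S)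
    (hm : 𝒢₀ ≤ mΩ) (F : Lp ℝ 2 ((volume.restrict S).prod P))
    (hsec : ∀ᵐ t ∂(volume.restrict S), AEStronglyMeasurable[𝒢₀] (fun ω ↦ F (t, ω)) P) :
    F ∈ (elementarySpan 𝒢₀ P S).topologicalClosure := by
  set K := (elementarySpan 𝒢₀ P S).topologicalClosure with hK
  have : CompleteSpace K := (Submodule.isClosed_topologicalClosure _).completeSpace_coe
  set G := F - K.starProjection F with hGdef
  have hGorth : G ∈ (elementarySpan 𝒢₀ P S)ᗮ := by
    have := Submodule.sub_starProjection_mem_orthogonal (K := K) F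
    exact Submodule.orthogonal_le (Submodule.le_topologicalClosure _) this
  have hGsec : ∀ᵐ t ∂(volume.restrict S), AEStronglyMeasurable[𝒢₀] (fun ω ↦ G (t, ω)) P := by
    filter_upwards [hsec, section_aestronglyMeasurable_of_mem_closure
      (K.starProjection_apply_mem F), Measure.ae_ae_of_ae_prod
      (Lp.coeFn_sub F (K.starProjection F))] with t h1 h2 h3
    exact (h1.sub h2).congr (Filter.EventuallyEq.symm h3)
  obtain ⟨a, b, ha, hb, hab⟩ := hSe
  have hzero : ∀ n, ∀ᵐ p ∂((volume.restrict S).prod P).restrict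
      (Set.Ioc (a n) (b n) ×ˢ Set.univ), G p = 0 := by
    intro n
    have hfin := isFiniteMeasure_strip (P := P) (S := S) (a n) (b n)
    have hGi : IntegrableOn G (Set.Ioc (a n) (b n) ×ˢ Set.univ) ((volume.restrict S).prod P) :=
      ((Lp.memLp G).restrict _).integrable (by norm_num)
    have hrw : ((volume.restrict S).prod P).restrict (Set.Ioc (a n) (b n) ×ˢ Set.univ) =
        ((volume.restrict S).restrict (Set.Ioc (a n) (b n))).prod P := by
      rw [← Measure.prod_restrict, Measure.restrict_univ]
    have hGi' := hGi
    rw [IntegrableOn, hrw] at hGi'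
    rw [hrw]
    refine ae_eq_zero_of_forall_rectangle hGi' (fun c d A hA ↦ ?_) ?_
    · rw [← hrw, Measure.restrict_restrict (measurableSet_Ioc.prod hA), Set.prod_inter_prod,
        Set.inter_univ, Set.Ioc_inter_Ioc]
      by_cases hlt : max c (a n) < min d (b n)
      · refine setIntegral_rectangle_eq_zero hm hGorth hGsec (hS.out (ha n) (hb n) ?_)
          (hS.out (ha n) (hb n) ?_) hA
        · exact ⟨le_max_right _ _, hlt.le.trans (min_le_right _ _)⟩
        · exact ⟨(le_max_right _ _).trans hlt.le, min_le_right _ _⟩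
      · have : Set.Ioc (max c (a n)) (min d (b n)) = ∅ := Set.Ioc_eq_empty hlt
        rw [this]
        simp
    · rw [← hrw]
      exact setIntegral_rectangle_eq_zero hm hGorth hGsec (ha n) (hb n) MeasurableSet.univ
  have hG0 : G = 0 := by
    refine (Lp.eq_zero_iff_ae_eq_zero).2 ?_
    have h1 : ∀ᵐ p ∂((volume.restrict S).prod P), ∀ n, p ∈ Set.Ioc (a n) (b n) ×ˢ
        (Set.univ : Set Ω) → G p = 0 :=
      ae_all_iff.2 fun n ↦ (ae_restrict_iff' (measurableSet_Ioc.prod MeasurableSet.univ)).1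
        (hzero n)
    have h2 : ∀ᵐ p ∂((volume.restrict S).prod P), ∃ n, p.1 ∈ Set.Ioc (a n) (b n) :=
      Measure.quasiMeasurePreserving_fst.ae hab
    filter_upwards [h1, h2] with p h1 h2
    obtain ⟨n, hn⟩ := h2
    exact h1 n ⟨hn, Set.mem_univ _⟩
  have hFK : F = K.starProjection F := sub_eq_zero.1 hG0
  rw [hFK]
  exact K.starProjection_apply_mem F

/-- A square integrable process on `S` whose values are known before all times of `S` has an Itô
integral. -/
lemma exists_isItoIntegral (hB : IsTwoSidedBrownianMotion B P) (hS : S.OrdConnected)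
    (hSn : S.Nonempty) (hSe : IsExhaustedByIoc S) (h𝒢₀ : ∀ u ∈ S, 𝒢₀ ≤ brownianPast B P u)
    {f : ℝ → Ω → ℝ} (hf : MemLp (fun p : ℝ × Ω ↦ f p.1 p.2) 2 ((volume.restrict S).prod P))
    (hsec : ∀ᵐ t ∂(volume.restrict S), AEStronglyMeasurable[𝒢₀] (f t) P) :
    ∃ I, IsItoIntegral B P S f I := by
  have hm : 𝒢₀ ≤ mΩ := by
    obtain ⟨u, hu⟩ := hSn
    exact (h𝒢₀ u hu).trans (brownianPast_le hB u)
  have hmem := mem_closure_elementarySpan hS hSe hm (hf.toLp _) (by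
    filter_upwards [hsec, Measure.ae_ae_of_ae_prod hf.coeFn_toLp] with t h1 h2
    exact h1.congr (Filter.EventuallyEq.symm h2))
  obtain ⟨x, hx, hxF⟩ := mem_closure_iff_seq_limit.1 hmem
  choose φ hφ using fun n ↦ exists_simpleAdaptedProcess_of_mem_span (B := B) hSn h𝒢₀ (hx n)
  refine exists_isItoIntegral_of_tendsto hB hS hf φ ?_
  refine ((Lp.tendsto_Lp_iff_tendsto_eLpNorm' _ _).1 hxF).congr fun n ↦ ?_
  rw [eLpNorm_sub_comm]
  refine eLpNorm_congr_ae ?_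
  filter_upwards [hf.coeFn_toLp, hφ n] with p h1 h2
  rw [Pi.sub_apply, h1, h2]

lemma isExhaustedByIoc_Icc {s T : ℝ} (h : s ≤ T) : IsExhaustedByIoc (Set.Icc s T) := by
  refine ⟨fun _ ↦ s, fun _ ↦ T, fun _ ↦ ⟨le_rfl, h⟩, fun _ ↦ ⟨h, le_rfl⟩, ?_⟩
  rw [← Measure.restrict_congr_set (Ioc_ae_eq_Icc (μ := volume) (a := s) (b := T))]
  filter_upwards [ae_restrict_mem measurableSet_Ioc] with t ht
  exact ⟨0, ht⟩

lemma isExhaustedByIoc_Iic (s : ℝ) : IsExhaustedByIoc (Set.Iic s) := by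
  refine ⟨fun n ↦ s - n, fun _ ↦ s, fun n ↦ by simp, fun _ ↦ Set.mem_Iic.2 le_rfl, ?_⟩
  filter_upwards [ae_restrict_mem measurableSet_Iic] with t ht
  obtain ⟨n, hn⟩ := exists_nat_gt (s - t)
  exact ⟨n, by linarith, ht⟩

end Density

/-! ### Fractional integrals of square integrable processes -/

section FractionalIntegral

open scoped ENNReal

lemma eLpNorm_two_sq {α : Type*} [MeasurableSpace α] {μ : Measure α} (f : α → ℝ) :
    eLpNorm f 2 μ ^ 2 = ∫⁻ x, ‖f x‖ₑ ^ 2 ∂μ := by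
  have h := eLpNorm_nnreal_pow_eq_lintegral (μ := μ) (f := f) (p := 2) two_ne_zero
  simpa using h

lemma memLp_two_iff_lintegral {α : Type*} [MeasurableSpace α] {μ : Measure α} {f : α → ℝ}
    (hf : AEStronglyMeasurable f μ) : MemLp f 2 μ ↔ ∫⁻ x, ‖f x‖ₑ ^ 2 ∂μ < ∞ := by
  rw [← eLpNorm_two_sq]
  refine ⟨fun h ↦ ENNReal.pow_lt_top h.2, fun h ↦ ⟨hf, ?_⟩⟩
  by_contra hn
  rw [not_lt, top_le_iff] at hn
  simp [hn] at h

/-- The Cauchy–Schwarz inequality for a weighted integral. -/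
lemma sq_lintegral_mul_le {α : Type*} [MeasurableSpace α] (μ : Measure α) {k g : α → ℝ≥0∞}
    (hk : Measurable k) (hg : Measurable g) :
    (∫⁻ x, k x * g x ∂μ) ^ 2 ≤ (∫⁻ x, k x ∂μ) * ∫⁻ x, k x * g x ^ 2 ∂μ := by
  have h := ENNReal.lintegral_mul_le_Lp_mul_Lq (μ.withDensity k) Real.HolderConjugate.two_two
    (f := fun _ ↦ 1) (g := g) aemeasurable_const hg.aemeasurable
  have e1 : ∫⁻ x, ((fun _ ↦ 1 : α → ℝ≥0∞) * g) x ∂(μ.withDensity k) = ∫⁻ x, k x * g x ∂μ := by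
    rw [lintegral_withDensity_eq_lintegral_mul _ hk (measurable_const.mul hg)]
    simp
  have e2 : ∫⁻ _, (1 : ℝ≥0∞) ^ (2 : ℝ) ∂(μ.withDensity k) = ∫⁻ x, k x ∂μ := by
    simp [withDensity_apply]
  have e3 : ∫⁻ x, g x ^ (2 : ℝ) ∂(μ.withDensity k) = ∫⁻ x, k x * g x ^ 2 ∂μ := by
    rw [lintegral_withDensity_eq_lintegral_mul _ hk (hg.pow_const _)]
    simp
  rw [e1, e2, e3] at h
  refine (pow_le_pow_left₀ (zero_le) h 2).trans_eq ?_
  rw [mul_pow, ← ENNReal.rpow_natCast, ← ENNReal.rpow_natCast, ← ENNReal.rpow_mul,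
    ← ENNReal.rpow_mul]
  norm_num

/-- Young's inequality `‖κ * g‖₂ ≤ ‖κ‖₁ ‖g‖₂` on a subset of the line. -/
lemma lintegral_sq_convolution_le (S : Set ℝ) {κ g : ℝ → ℝ≥0∞} (hκ : Measurable κ)
    (hg : Measurable g) :
    ∫⁻ τ in S, (∫⁻ t in S, κ (t - τ) * g t) ^ 2 ≤ (∫⁻ u, κ u) ^ 2 * ∫⁻ t in S, g t ^ 2 := by
  have hκ2 : Measurable fun q : ℝ × ℝ ↦ κ (q.2 - q.1) := hκ.comp (measurable_snd.sub measurable_fst)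
  have h1 : ∀ τ, (∫⁻ t in S, κ (t - τ) * g t) ^ 2 ≤
      (∫⁻ u, κ u) * ∫⁻ t in S, κ (t - τ) * g t ^ 2 := by
    intro τ
    refine (sq_lintegral_mul_le _ (hκ.comp (measurable_id.sub_const τ)) hg).trans ?_
    refine mul_le_mul' ?_ le_rfl
    exact (setLIntegral_le_lintegral _ _).trans_eq (lintegral_sub_right_eq_self (μ := volume) κ τ)
  calc ∫⁻ τ in S, (∫⁻ t in S, κ (t - τ) * g t) ^ 2
      ≤ ∫⁻ τ in S, (∫⁻ u, κ u) * ∫⁻ t in S, κ (t - τ) * g t ^ 2 := lintegral_mono h1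
    _ = (∫⁻ u, κ u) * ∫⁻ τ in S, ∫⁻ t in S, κ (t - τ) * g t ^ 2 :=
        lintegral_const_mul _ (Measurable.lintegral_prod_right
          (hκ2.mul ((hg.pow_const 2).comp measurable_snd)))
    _ = (∫⁻ u, κ u) * ∫⁻ t in S, ∫⁻ τ in S, κ (t - τ) * g t ^ 2 := by
        rw [lintegral_lintegral_swap (hκ2.mul ((hg.pow_const 2).comp measurable_snd)).aemeasurable]
    _ ≤ (∫⁻ u, κ u) * ∫⁻ t in S, (∫⁻ u, κ u) * g t ^ 2 := by
        gcongr with t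
        have hκt : Measurable fun τ ↦ κ (t - τ) := hκ.comp (measurable_const.sub measurable_id)
        rw [lintegral_mul_const _ hκt]
        refine mul_le_mul' ?_ le_rfl
        exact (setLIntegral_le_lintegral _ _).trans_eq (lintegral_sub_left_eq_self (μ := volume) κ t)
    _ = (∫⁻ u, κ u) ^ 2 * ∫⁻ t in S, g t ^ 2 := by
        rw [lintegral_const_mul _ (hg.pow_const 2), sq, mul_assoc]

/-- The kernel `u^{H - 3/2}`, `0 < u ≤ L`, of the fractional integral of order `H - 1/2`. -/
def fracKernel (H L : ℝ) : ℝ → ℝ := (Set.Ioc 0 L).indicator fun u ↦ u ^ (H - 3 / 2)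

lemma measurable_fracKernel (H L : ℝ) : Measurable (fracKernel H L) :=
  (measurable_id.pow_const _).indicator measurableSet_Ioc

lemma lintegral_fracKernel_lt_top {H L : ℝ} (hH : 1 / 2 < H) :
    ∫⁻ u, ‖fracKernel H L u‖ₑ < ∞ := by
  rcases le_total 0 L with hL | hL
  · have h := (intervalIntegral.intervalIntegrable_rpow' (a := 0) (b := L)
      (r := H - 3 / 2) (by linarith)).1
    exact ((integrable_indicator_iff measurableSet_Ioc).2 h).2
  · simp [fracKernel, Set.Ioc_eq_empty_of_le hL]

lemma fracKernel_sub_mul_eq {H s T τ : ℝ} (hτ : s ≤ τ) (g : ℝ → ℝ) {t : ℝ}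
    (ht : t ∈ Set.Icc s T) : fracKernel H (T - s) (t - τ) * g t =
      (Set.Ioc τ T).indicator (fun t ↦ (t - τ) ^ (H - 3 / 2) * g t) t := by
  by_cases h : τ < t
  · have h1 : t - τ ∈ Set.Ioc 0 (T - s) := ⟨by linarith, by linarith [ht.2]⟩
    have h2 : t ∈ Set.Ioc τ T := ⟨h, ht.2⟩
    rw [fracKernel, Set.indicator_of_mem h1, Set.indicator_of_mem h2]
  · have h1 : t - τ ∉ Set.Ioc 0 (T - s) := fun hh ↦ h (by linarith [hh.1])
    have h2 : t ∉ Set.Ioc τ T := fun hh ↦ h hh.1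
    rw [fracKernel, Set.indicator_of_notMem h1, Set.indicator_of_notMem h2, zero_mul]

lemma Icc_inter_Ioc_of_le {s T τ : ℝ} (hτ : s ≤ τ) : Set.Icc s T ∩ Set.Ioc τ T = Set.Ioc τ T :=
  Set.inter_eq_right.2 fun _ h ↦ ⟨hτ.trans h.1.le, h.2⟩

lemma fbmG_eq_integral_fracKernel {H s T τ : ℝ} (hτ : τ ∈ Set.Icc s T) (g : ℝ → ℝ) :
    fbmG H T g τ = fbmConst H * (H - 1 / 2) *
      ∫ t in Set.Icc s T, fracKernel H (T - s) (t - τ) * g t := by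
  rw [fbmG, intervalIntegral.integral_of_le hτ.2,
    setIntegral_congr_fun measurableSet_Icc fun t ht ↦ fracKernel_sub_mul_eq hτ.1 g ht,
    setIntegral_indicator measurableSet_Ioc, Icc_inter_Ioc_of_le hτ.1]

lemma intervalIntegrable_of_integrable_fracKernel {H s T τ : ℝ} (hτ : τ ∈ Set.Icc s T)
    {g : ℝ → ℝ}
    (h : Integrable (fun t ↦ fracKernel H (T - s) (t - τ) * g t) (volume.restrict (Set.Icc s T))) :
    IntervalIntegrable (fun t ↦ (t - τ) ^ (H - 3 / 2) * g t) volume τ T := by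
  rw [intervalIntegrable_iff_integrableOn_Ioc_of_le hτ.2]
  have h1 : IntegrableOn ((Set.Ioc τ T).indicator fun t ↦ (t - τ) ^ (H - 3 / 2) * g t)
      (Set.Icc s T) :=
    IntegrableOn.congr_fun h (fun t ht ↦ fracKernel_sub_mul_eq hτ.1 g ht) measurableSet_Icc
  rw [integrableOn_indicator_iff measurableSet_Ioc, Set.inter_comm, Icc_inter_Ioc_of_le hτ.1] at h1
  exact h1

variable {Ω : Type*} [MeasurableSpace Ω] {P : Measure Ω} [SFinite P] {H s T : ℝ} {γ : ℝ × Ω → ℝ}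

/-- The absolute fractional integral of a square integrable process is square integrable. -/
lemma lintegral_sq_fracKernel_lt_top (hH : 1 / 2 < H) (hγ : StronglyMeasurable γ)
    (hγ2 : MemLp γ 2 ((volume.restrict (Set.Icc s T)).prod P)) :
    ∫⁻ p : ℝ × Ω, (∫⁻ t in Set.Icc s T, ‖fracKernel H (T - s) (t - p.1) * γ (t, p.2)‖ₑ) ^ 2
      ∂((volume.restrict (Set.Icc s T)).prod P) < ∞ := by
  set μ := volume.restrict (Set.Icc s T)
  have hκ : Measurable fun u ↦ ‖fracKernel H (T - s) u‖ₑ := (measurable_fracKernel _ _).enorm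
  have hm : Measurable fun q : (ℝ × Ω) × ℝ ↦
      ‖fracKernel H (T - s) (q.2 - q.1.1) * γ (q.2, q.1.2)‖ₑ := by
    refine Measurable.enorm (Measurable.mul ?_ ?_)
    · exact (measurable_fracKernel _ _).comp (measurable_snd.sub measurable_fst.fst)
    · exact hγ.measurable.comp (measurable_snd.prodMk measurable_fst.snd)
  rw [lintegral_prod_symm _ ((hm.lintegral_prod_right').pow_const 2).aemeasurable]
  have hγ3 := (memLp_two_iff_lintegral hγ2.1).1 hγ2
  rw [lintegral_prod_symm _ (hγ.measurable.enorm.pow_const 2).aemeasurable] at hγ3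
  calc ∫⁻ ω, ∫⁻ τ, (∫⁻ t, ‖fracKernel H (T - s) (t - τ) * γ (t, ω)‖ₑ ∂μ) ^ 2 ∂μ ∂P
      ≤ ∫⁻ ω, (∫⁻ u, ‖fracKernel H (T - s) u‖ₑ) ^ 2 * ∫⁻ t, ‖γ (t, ω)‖ₑ ^ 2 ∂μ ∂P := by
        refine lintegral_mono fun ω ↦ ?_
        simp only [enorm_mul]
        exact lintegral_sq_convolution_le _ hκ (hγ.measurable.comp measurable_prodMk_right).enorm
    _ = (∫⁻ u, ‖fracKernel H (T - s) u‖ₑ) ^ 2 * ∫⁻ ω, ∫⁻ t, ‖γ (t, ω)‖ₑ ^ 2 ∂μ ∂P :=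
        lintegral_const_mul _ (hγ.measurable.enorm.pow_const 2).lintegral_prod_left'
    _ < ∞ := ENNReal.mul_lt_top (ENNReal.pow_lt_top (lintegral_fracKernel_lt_top hH)) hγ3

lemma ae_integrable_fracKernel (hH : 1 / 2 < H) (hγ : StronglyMeasurable γ)
    (hγ2 : MemLp γ 2 ((volume.restrict (Set.Icc s T)).prod P)) :
    ∀ᵐ p ∂((volume.restrict (Set.Icc s T)).prod P), Integrable
      (fun t ↦ fracKernel H (T - s) (t - p.1) * γ (t, p.2)) (volume.restrict (Set.Icc s T)) := by
  have hm : Measurable fun q : (ℝ × Ω) × ℝ ↦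
      fracKernel H (T - s) (q.2 - q.1.1) * γ (q.2, q.1.2) :=
    ((measurable_fracKernel _ _).comp (measurable_snd.sub measurable_fst.fst)).mul
      (hγ.measurable.comp (measurable_snd.prodMk measurable_fst.snd))
  filter_upwards [ae_lt_top ((hm.enorm.lintegral_prod_right').pow_const 2)
    (lintegral_sq_fracKernel_lt_top hH hγ hγ2).ne] with p hp
  refine ⟨(hm.comp measurable_prodMk_left).aestronglyMeasurable, ?_⟩
  by_contra hn
  rw [HasFiniteIntegral, not_lt, top_le_iff] at hn
  rw [hn] at hp
  simp at hp

lemma ae_integrable_prod_fracKernel [IsFiniteMeasure P] (hH : 1 / 2 < H)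
    (hγ : StronglyMeasurable γ) (hγ2 : MemLp γ 2 ((volume.restrict (Set.Icc s T)).prod P)) :
    ∀ᵐ τ ∂(volume.restrict (Set.Icc s T)), Integrable
      (fun q : ℝ × Ω ↦ fracKernel H (T - s) (q.1 - τ) * γ q)
      ((volume.restrict (Set.Icc s T)).prod P) := by
  have hm : Measurable fun q : (ℝ × Ω) × ℝ ↦
      fracKernel H (T - s) (q.2 - q.1.1) * γ (q.2, q.1.2) :=
    ((measurable_fracKernel _ _).comp (measurable_snd.sub measurable_fst.fst)).mul
      (hγ.measurable.comp (measurable_snd.prodMk measurable_fst.snd))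
  have hm2 := (hm.enorm.lintegral_prod_right' (ν := volume.restrict (Set.Icc s T)))
  have h := lintegral_sq_fracKernel_lt_top hH hγ hγ2
  rw [lintegral_prod _ (hm2.pow_const 2).aemeasurable] at h
  filter_upwards [ae_lt_top (hm2.pow_const 2).lintegral_prod_right' h.ne] with τ hτ
  have hmτ : Measurable fun q : ℝ × Ω ↦ fracKernel H (T - s) (q.1 - τ) * γ q :=
    ((measurable_fracKernel _ _).comp (measurable_fst.sub_const τ)).mul hγ.measurable
  refine ⟨hmτ.aestronglyMeasurable, ?_⟩
  rw [HasFiniteIntegral, lintegral_prod_symm _ hmτ.enorm.aemeasurable]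
  -- `x ≤ x² + 1` bounds the first moment by the second one
  refine lt_of_le_of_lt (lintegral_mono fun ω ↦
    (?_ : _ ≤ (∫⁻ t in Set.Icc s T, ‖fracKernel H (T - s) (t - τ) * γ (t, ω)‖ₑ) ^ 2 + 1)) ?_
  · set x := ∫⁻ t in Set.Icc s T, ‖fracKernel H (T - s) (t - τ) * γ (t, ω)‖ₑ
    rcases le_total x 1 with h | h
    · exact h.trans le_add_self
    · refine le_trans ?_ le_self_add
      rw [sq]
      exact le_mul_of_one_le_right (zero_le) h
  · rw [lintegral_add_right _ measurable_const]
    exact ENNReal.add_lt_top.2 ⟨hτ, by simp⟩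

lemma memLp_fractionalIntegral (hH : 1 / 2 < H) (hγ : StronglyMeasurable γ)
    (hγ2 : MemLp γ 2 ((volume.restrict (Set.Icc s T)).prod P)) :
    MemLp (fun p : ℝ × Ω ↦ ∫ t in Set.Icc s T, fracKernel H (T - s) (t - p.1) * γ (t, p.2)) 2
      ((volume.restrict (Set.Icc s T)).prod P) := by
  have hm : Measurable fun q : (ℝ × Ω) × ℝ ↦
      fracKernel H (T - s) (q.2 - q.1.1) * γ (q.2, q.1.2) :=
    ((measurable_fracKernel _ _).comp (measurable_snd.sub measurable_fst.fst)).mul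
      (hγ.measurable.comp (measurable_snd.prodMk measurable_fst.snd))
  refine (memLp_two_iff_lintegral
    (hm.stronglyMeasurable.integral_prod_right').aestronglyMeasurable).2 ?_
  refine lt_of_le_of_lt (lintegral_mono fun p ↦ ?_) (lintegral_sq_fracKernel_lt_top hH hγ hγ2)
  exact pow_le_pow_left₀ (zero_le) (enorm_integral_le_lintegral_enorm _) 2

end FractionalIntegral

/-! ### The process `𝒟R_H` -/

section DR

open scoped ENNReal

/-- The integrand `c_H f'_t(t, q) = c_H (H - 1/2) (t - q)^{H - 3/2}` of `𝒟R_H(t)`. -/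
def drKernel (H t q : ℝ) : ℝ := fbmConst H * ((H - 1 / 2) * (t - q) ^ (H - 3 / 2))

lemma deriv_fbmKernel {H s t q : ℝ} (hq : q < t) :
    fbmConst H * deriv (fun u ↦ fbmKernel H s u q) t = drKernel H t q := by
  have h : HasDerivAt (fun u : ℝ ↦ fbmKernel H s u q) ((H - 1 / 2) * (t - q) ^ (H - 3 / 2)) t := by
    have h1 := (((hasDerivAt_id t).sub_const q).rpow_const (p := H - 1 / 2)
      (Or.inl (sub_ne_zero.2 hq.ne'))).sub_const ((s - q) ^ (H - 1 / 2))
    rw [show H - 1 / 2 - 1 = H - 3 / 2 by ring, one_mul] at h1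
    exact h1
  rw [h.deriv, drKernel]

/-- The tangent line of the convex function `x ↦ x ^ p`, `p ≤ 0`. -/
lemma rpow_sub_rpow_le {x y p : ℝ} (hx : 0 < x) (hxy : x ≤ y) (hp : p ≤ 0) :
    x ^ p - y ^ p ≤ -p * ((y - x) / x) * x ^ p := by
  have hy : 0 < y := hx.trans_le hxy
  have hr : 0 < y / x := div_pos hy hx
  have h1 : 1 + p * (y / x - 1) ≤ (y / x) ^ p := by
    have h2 : Real.log (y / x) ≤ y / x - 1 := Real.log_le_sub_one_of_pos hr
    have h3 : p * (y / x - 1) ≤ Real.log (y / x) * p := by nlinarith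
    calc 1 + p * (y / x - 1) ≤ Real.log (y / x) * p + 1 := by linarith
      _ ≤ Real.exp (Real.log (y / x) * p) := Real.add_one_le_exp _
      _ = (y / x) ^ p := (Real.rpow_def_of_pos hr p).symm
  have h4 : y ^ p = (y / x) ^ p * x ^ p := by
    rw [← Real.mul_rpow hr.le hx.le, div_mul_cancel₀ _ hx.ne']
  have h5 : (y - x) / x = y / x - 1 := by field_simp
  rw [h4, h5]
  nlinarith [Real.rpow_pos_of_pos hx p]

/-- In mean square, `𝒟R_H` is locally Lipschitz from the right; the kernel satisfies the
corresponding pointwise bound. -/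
lemma abs_drKernel_sub_le {H s t t' q : ℝ} (hH : H ≤ 3 / 2) (hst : s < t) (htt' : t ≤ t')
    (hq : q ≤ s) :
    |drKernel H t' q - drKernel H t q| ≤ (3 / 2 - H) * ((t' - t) / (t - s)) * |drKernel H t q| := by
  have hx : 0 < t - q := by linarith
  have h1 := rpow_sub_rpow_le hx (show t - q ≤ t' - q by linarith)
    (show H - 3 / 2 ≤ 0 by linarith)
  have h2 : (t' - q) ^ (H - 3 / 2) ≤ (t - q) ^ (H - 3 / 2) :=
    Real.rpow_le_rpow_of_nonpos hx (by linarith) (by linarith)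
  have h3 : (t' - q - (t - q)) / (t - q) ≤ (t' - t) / (t - s) := by
    rw [show t' - q - (t - q) = t' - t by ring]
    exact div_le_div_of_nonneg_left (by linarith) (by linarith) (by linarith)
  have h0 : 0 ≤ (t - q) ^ (H - 3 / 2) := Real.rpow_nonneg hx.le _
  have h4 : |(t' - q) ^ (H - 3 / 2) - (t - q) ^ (H - 3 / 2)| ≤
      (3 / 2 - H) * ((t' - t) / (t - s)) * (t - q) ^ (H - 3 / 2) := by
    rw [abs_sub_comm, abs_of_nonneg (by linarith)]
    refine h1.trans ?_
    rw [show -(H - 3 / 2) = 3 / 2 - H by ring]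
    gcongr
  simp only [drKernel]
  rw [show fbmConst H * ((H - 1 / 2) * (t' - q) ^ (H - 3 / 2)) -
      fbmConst H * ((H - 1 / 2) * (t - q) ^ (H - 3 / 2)) = (fbmConst H * (H - 1 / 2)) *
      ((t' - q) ^ (H - 3 / 2) - (t - q) ^ (H - 3 / 2)) by ring, ← mul_assoc (fbmConst H), abs_mul,
    abs_mul _ ((t - q) ^ _), abs_of_nonneg h0]
  calc _ ≤ |fbmConst H * (H - 1 / 2)| *
        ((3 / 2 - H) * ((t' - t) / (t - s)) * (t - q) ^ (H - 3 / 2)) := by gcongr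
    _ = _ := by ring

lemma measurable_drKernel (H t : ℝ) : Measurable (drKernel H t) :=
  (((measurable_const.sub measurable_id).pow_const _).const_mul _).const_mul _

/-- The second moment of `𝒟R_H(t)`. -/
lemma lintegral_sq_drKernel {H s t : ℝ} (hH : H < 1) (hst : s < t) :
    ∫⁻ q in Set.Iic s, ‖drKernel H t q‖ₑ ^ 2 =
      ENNReal.ofReal ((fbmConst H * (H - 1 / 2)) ^ 2 / (2 - 2 * H) * (t - s) ^ (2 * H - 2)) := by
  have hpos : 0 < t - s := sub_pos.2 hst
  have hmp := Measure.measurePreserving_sub_left (volume : Measure ℝ) t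
  have hpre : (fun q ↦ t - q) ⁻¹' Set.Ici (t - s) = Set.Iic s := by
    ext q; simp
  have hmeas : Measurable fun u : ℝ ↦
      ENNReal.ofReal ((fbmConst H * (H - 1 / 2)) ^ 2 * u ^ (2 * H - 3)) :=
    ((measurable_id.pow_const _).const_mul _).ennreal_ofReal
  have e1 : ∫⁻ q in Set.Iic s, ‖drKernel H t q‖ₑ ^ 2 =
      ∫⁻ q in Set.Iic s, ENNReal.ofReal ((fbmConst H * (H - 1 / 2)) ^ 2 *
        (t - q) ^ (2 * H - 3)) := by
    refine setLIntegral_congr_fun measurableSet_Iic fun q hq ↦ ?_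
    have hx : 0 < t - q := by have := Set.mem_Iic.1 hq; linarith
    rw [Real.enorm_eq_ofReal_abs, ← ENNReal.ofReal_pow (abs_nonneg _), sq_abs, drKernel,
      ← mul_assoc, mul_pow, ← Real.rpow_natCast ((t - q) ^ _), ← Real.rpow_mul hx.le]
    congr 3
    push_cast; ring
  rw [e1, ← hpre, hmp.setLIntegral_comp_preimage measurableSet_Ici hmeas,
    ← restrict_Ioi_eq_restrict_Ici, ← ofReal_integral_eq_lintegral_ofReal, integral_const_mul,
    integral_Ioi_rpow_of_lt (by linarith) hpos]
  · congr 1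
    rw [show 2 * H - 3 + 1 = 2 * H - 2 by ring, show (2 - 2 * H) = -(2 * H - 2) by ring]
    rw [div_neg, neg_div]
    ring
  · exact (integrableOn_Ioi_rpow_of_lt (by linarith) hpos).const_mul _
  · filter_upwards [ae_restrict_mem measurableSet_Ioi] with u hu
    have : 0 < u := hpos.trans hu
    positivity

variable {Ω : Type*} [MeasurableSpace Ω] {B : ℝ → Ω → ℝ} {P : Measure Ω} {H s T : ℝ}

lemma ae_deriv_fbmKernel {t : ℝ} (hst : s < t) :
    (fun p : ℝ × Ω ↦ fbmConst H * deriv (fun u ↦ fbmKernel H s u p.1) t)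
      =ᵐ[(volume.restrict (Set.Iic s)).prod P] fun p ↦ drKernel H t p.1 := by
  refine Measure.quasiMeasurePreserving_fst.ae (p := fun q ↦
    fbmConst H * deriv (fun u ↦ fbmKernel H s u q) t = drKernel H t q) ?_
  filter_upwards [ae_restrict_mem measurableSet_Iic] with q hq
  exact deriv_fbmKernel (lt_of_le_of_lt hq hst)

lemma IsDR.section_aestronglyMeasurable (hB : IsTwoSidedBrownianMotion B P) {D : ℝ → Ω → ℝ}
    (hD : IsDR B P H s T D) : ∀ᵐ t ∂(volume.restrict (Set.Ioc s T)),
      AEStronglyMeasurable[brownianPast B P s] (D t) P := by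
  filter_upwards [ae_restrict_mem measurableSet_Ioc] with t ht
  exact (hD.2 t ht).aestronglyMeasurable_past hB subset_rfl

variable [IsProbabilityMeasure P]

lemma eLpNorm_comp_fst {μ : Measure ℝ} {f : ℝ → ℝ} (hf : Measurable f) :
    eLpNorm (fun p : ℝ × Ω ↦ f p.1) 2 (μ.prod P) = eLpNorm f 2 μ :=
  eLpNorm_comp_measurePreserving hf.aestronglyMeasurable
    (measurePreserving_fst (μ := μ) (ν := P))

lemma memLp_drKernel (hH : H < 1) {t : ℝ} (hst : s < t) :
    MemLp (fun p : ℝ × Ω ↦ fbmConst H * deriv (fun u ↦ fbmKernel H s u p.1) t) 2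
      ((volume.restrict (Set.Iic s)).prod P) := by
  refine MemLp.ae_eq (ae_deriv_fbmKernel hst).symm ?_
  have h : MemLp (drKernel H t) 2 (volume.restrict (Set.Iic s)) :=
    (memLp_two_iff_lintegral (measurable_drKernel H t).aestronglyMeasurable).2
      (by rw [lintegral_sq_drKernel hH hst]; exact ENNReal.ofReal_lt_top)
  exact h.comp_measurePreserving (measurePreserving_fst (μ := volume.restrict (Set.Iic s)) (ν := P))

/-- The Wiener integral defining `𝒟R_H(t)` exists. -/
lemma exists_isItoIntegral_drKernel (hB : IsTwoSidedBrownianMotion B P) (hH : H < 1) {t : ℝ}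
    (hst : s < t) : ∃ X, IsItoIntegral B P (Set.Iic s)
      (fun q _ ↦ fbmConst H * deriv (fun u ↦ fbmKernel H s u q) t) X :=
  exists_isItoIntegral (𝒢₀ := ⊥) hB Set.ordConnected_Iic Set.nonempty_Iic (isExhaustedByIoc_Iic s)
    (fun _ _ ↦ bot_le) (memLp_drKernel hH hst)
    (ae_of_all _ fun _ ↦ stronglyMeasurable_const.aestronglyMeasurable)

/-- `E 𝒟R_H(t)² = const (t - s)^{2H - 2}`. -/
lemma lintegral_sq_of_isItoIntegral_drKernel (hB : IsTwoSidedBrownianMotion B P) (hH : H < 1)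
    {t : ℝ} (hst : s < t) {X : Ω → ℝ} (hX : IsItoIntegral B P (Set.Iic s)
      (fun q _ ↦ fbmConst H * deriv (fun u ↦ fbmKernel H s u q) t) X) :
    ∫⁻ ω, ‖X ω‖ₑ ^ 2 ∂P =
      ENNReal.ofReal ((fbmConst H * (H - 1 / 2)) ^ 2 / (2 - 2 * H) * (t - s) ^ (2 * H - 2)) := by
  rw [← eLpNorm_two_sq, hX.eLpNorm_eq hB Set.ordConnected_Iic Set.nonempty_Iic,
    eLpNorm_congr_ae (ae_deriv_fbmKernel hst), eLpNorm_comp_fst (measurable_drKernel H t),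
    eLpNorm_two_sq, lintegral_sq_drKernel hH hst]

lemma eLpNorm_sub_le_of_isItoIntegral_drKernel (hB : IsTwoSidedBrownianMotion B P) (hH : H < 1)
    {t t' : ℝ} (hst : s < t) (htt' : t ≤ t') {X X' : Ω → ℝ}
    (hX : IsItoIntegral B P (Set.Iic s)
      (fun q _ ↦ fbmConst H * deriv (fun u ↦ fbmKernel H s u q) t) X)
    (hX' : IsItoIntegral B P (Set.Iic s)
      (fun q _ ↦ fbmConst H * deriv (fun u ↦ fbmKernel H s u q) t') X') :
    eLpNorm (fun ω ↦ X' ω - X ω) 2 P ≤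
      ENNReal.ofReal ((3 / 2 - H) * ((t' - t) / (t - s))) * eLpNorm X 2 P := by
  rw [hX'.eLpNorm_sub hB Set.ordConnected_Iic hX,
    hX.eLpNorm_eq hB Set.ordConnected_Iic Set.nonempty_Iic]
  refine eLpNorm_le_mul_eLpNorm_of_ae_le_mul ?_ 2
  have hmem : ∀ᵐ p : ℝ × Ω ∂((volume.restrict (Set.Iic s)).prod P), p.1 ∈ Set.Iic s :=
    Measure.quasiMeasurePreserving_fst.ae (ae_restrict_mem measurableSet_Iic)
  filter_upwards [hmem, ae_deriv_fbmKernel (H := H) (P := P) hst,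
    ae_deriv_fbmKernel (H := H) (P := P) (hst.trans_le htt')] with p hp h1 h2
  rw [h1, h2]
  exact abs_drKernel_sub_le (by linarith) hst htt' hp

/-- A process which, at each time, is approximated fast enough in `L₂` by its values at countably
many times, chosen measurably, has a jointly measurable version. -/
lemma exists_measurable_version {U : Set ℝ} {X : ℝ → Ω → ℝ}
    (hX : ∀ t ∈ U, AEStronglyMeasurable (X t) P) {e : ℕ → ℤ → ℝ} {j : ℕ → ℝ → ℤ}
    (hj : ∀ n, Measurable (j n)) (he : ∀ n, ∀ t ∈ U, e n (j n t) ∈ U)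
    (hsum : ∀ t ∈ U, ∑' n, eLpNorm (fun ω ↦ X (e n (j n t)) ω - X t ω) 2 P ≠ ∞) :
    ∃ D : ℝ → Ω → ℝ, Measurable (fun p : ℝ × Ω ↦ D p.1 p.2) ∧ ∀ t ∈ U, D t =ᵐ[P] X t := by
  classical
  let Y : ℝ → Ω → ℝ := fun t ↦ if h : t ∈ U then (hX t h).mk (X t) else 0
  have hYm : ∀ t, Measurable (Y t) := by
    intro t
    by_cases h : t ∈ U
    · simp only [Y, h, dif_pos]
      exact (hX t h).stronglyMeasurable_mk.measurable
    · simp only [Y, h, dif_neg, not_false_eq_true]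
      exact measurable_const
  have hYX : ∀ t ∈ U, X t =ᵐ[P] Y t := by
    intro t h
    simp only [Y, h, dif_pos]
    exact (hX t h).ae_eq_mk
  refine ⟨fun t ω ↦ limsup (fun n ↦ Y (e n (j n t)) ω) atTop, Measurable.limsup fun n ↦ ?_,
    fun t ht ↦ ?_⟩
  · have h1 : Measurable fun q : ℤ × Ω ↦ Y (e n q.1) q.2 :=
      measurable_from_prod_countable_right fun k ↦ hYm (e n k)
    exact h1.comp (((hj n).comp measurable_fst).prodMk measurable_snd)
  · have hm : ∀ n, AEStronglyMeasurable (fun ω ↦ X (e n (j n t)) ω - X t ω) P := fun n ↦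
      (hX _ (he n t ht)).sub (hX t ht)
    have hfin : ∫⁻ ω, ∑' n, ‖X (e n (j n t)) ω - X t ω‖ₑ ∂P ≠ ∞ := by
      rw [lintegral_tsum fun n ↦ (hm n).enorm]
      refine ne_top_of_le_ne_top (hsum t ht) (ENNReal.tsum_le_tsum fun n ↦ ?_)
      rw [← eLpNorm_one_eq_lintegral_enorm]
      exact eLpNorm_le_eLpNorm_of_exponent_le (by norm_num) (hm n)
    have hae := ae_lt_top' (AEMeasurable.tsum fun n ↦ (hm n).enorm) hfin
    filter_upwards [hae, hYX t ht, ae_all_iff.2 fun n ↦ hYX _ (he n t ht)] with ω h1 h2 h3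
    have h4 : Tendsto (fun n ↦ ‖X (e n (j n t)) ω - X t ω‖ₑ) atTop (𝓝 0) :=
      ENNReal.tendsto_atTop_zero_of_tsum_ne_top h1.ne
    have h5 : Tendsto (fun n ↦ X (e n (j n t)) ω) atTop (𝓝 (X t ω)) := by
      rw [tendsto_iff_edist_tendsto_0]
      simpa only [edist_eq_enorm_sub] using h4
    simp only [h3] at h5
    exact h5.limsup_eq

/-- The process `𝒟R_H` exists: dyadic times decreasing to `t` approximate it geometrically fast. -/
lemma exists_isDR (hB : IsTwoSidedBrownianMotion B P) (hH : H < 1) :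
    ∃ D, IsDR B P H s T D := by
  choose! X hX using fun t (ht : s < t) ↦ exists_isItoIntegral_drKernel (H := H) hB hH ht
  let e : ℕ → ℤ → ℝ := fun n k ↦ min T ((k + 1) / 2 ^ n)
  let j : ℕ → ℝ → ℤ := fun n t ↦ ⌊2 ^ n * t⌋
  have h2 : ∀ n : ℕ, (0 : ℝ) < 2 ^ n := fun n ↦ by positivity
  have hlow : ∀ n, ∀ t ∈ Set.Ioc s T, t ≤ e n (j n t) := by
    intro n t ht
    refine le_min ht.2 ?_
    rw [le_div_iff₀ (h2 n), mul_comm]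
    exact (Int.lt_floor_add_one _).le
  have hup : ∀ n t, e n (j n t) - t ≤ (1 / 2) ^ n := by
    intro n t
    have h3 : ((⌊2 ^ n * t⌋ : ℝ) + 1) / 2 ^ n ≤ t + (1 / 2) ^ n := by
      rw [div_le_iff₀ (h2 n), add_mul, ← mul_pow]
      norm_num
      linarith [Int.floor_le (2 ^ n * t)]
    linarith [min_le_right T (((⌊2 ^ n * t⌋ : ℝ) + 1) / 2 ^ n)]
  have he : ∀ n, ∀ t ∈ Set.Ioc s T, e n (j n t) ∈ Set.Ioc s T := fun n t ht ↦
    ⟨ht.1.trans_le (hlow n t ht), min_le_left _ _⟩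
  have hsum : ∀ t ∈ Set.Ioc s T,
      ∑' n, eLpNorm (fun ω ↦ X (e n (j n t)) ω - X t ω) 2 P ≠ ∞ := by
    intro t ht
    have hts : 0 < t - s := sub_pos.2 ht.1
    have hb : ∀ n, eLpNorm (fun ω ↦ X (e n (j n t)) ω - X t ω) 2 P ≤
        ENNReal.ofReal ((3 / 2 - H) / (t - s) * (1 / 2) ^ n) * eLpNorm (X t) 2 P := by
      intro n
      refine (eLpNorm_sub_le_of_isItoIntegral_drKernel hB hH ht.1 (hlow n t ht) (hX t ht.1)
        (hX _ (he n t ht).1)).trans ?_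
      refine mul_le_mul' (ENNReal.ofReal_le_ofReal ?_) le_rfl
      rw [div_mul_eq_mul_div, mul_div_assoc]
      have := hup n t
      have h3 : 0 ≤ 3 / 2 - H := by linarith
      gcongr
    refine ne_top_of_le_ne_top ?_ (ENNReal.tsum_le_tsum hb)
    rw [ENNReal.tsum_mul_right]
    refine ENNReal.mul_ne_top ?_ (hX t ht.1).2.1.2.ne
    exact (summable_geometric_two.mul_left _).tsum_ofReal_ne_top
  obtain ⟨D, hDm, hD⟩ := exists_measurable_version (P := P) (U := Set.Ioc s T) (X := X) (e := e)
    (j := j) (fun t ht ↦ (hX t ht.1).2.1.1)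
    (fun n ↦ Int.measurable_floor.comp (measurable_const_mul _)) he hsum
  exact ⟨D, hDm.aestronglyMeasurable, fun t ht ↦ (hX t ht.1).congr (hD t ht).symm⟩

lemma IsDR.memLp (hB : IsTwoSidedBrownianMotion B P) (hH : H ∈ Set.Ioo (1 / 2 : ℝ) 1) (hsT : s ≤ T)
    {D : ℝ → Ω → ℝ} (hD : IsDR B P H s T D) :
    MemLp (fun p : ℝ × Ω ↦ D p.1 p.2) 2 ((volume.restrict (Set.Ioc s T)).prod P) := by
  refine (memLp_two_iff_lintegral hD.1).2 ?_
  rw [lintegral_prod _ (hD.1.enorm.pow_const 2),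
    setLIntegral_congr_fun measurableSet_Ioc fun t ht ↦
      lintegral_sq_of_isItoIntegral_drKernel hB hH.2 ht.1 (hD.2 t ht)]
  have h1 : IntervalIntegrable (fun u : ℝ ↦ u ^ (2 * H - 2)) volume (s - s) (T - s) :=
    intervalIntegral.intervalIntegrable_rpow' (by linarith [hH.1])
  have h2 := ((h1.comp_sub_right s).const_mul
    ((fbmConst H * (H - 1 / 2)) ^ 2 / (2 - 2 * H)))
  simp only [sub_add_cancel] at h2
  rw [intervalIntegrable_iff_integrableOn_Ioc_of_le hsT] at h2
  exact h2.lintegral_lt_top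

lemma IsDR.ae_eq (hB : IsTwoSidedBrownianMotion B P) {D D' : ℝ → Ω → ℝ}
    (hD : IsDR B P H s T D) (hD' : IsDR B P H s T D') :
    (fun p : ℝ × Ω ↦ D p.1 p.2) =ᵐ[(volume.restrict (Set.Ioc s T)).prod P]
      fun p ↦ D' p.1 p.2 := by
  have h : ∀ᵐ t ∂(volume.restrict (Set.Ioc s T)), ∀ᵐ ω ∂P, D t ω = D' t ω := by
    filter_upwards [ae_restrict_mem measurableSet_Ioc] with t ht
    exact (hD.2 t ht).ae_eq hB Set.ordConnected_Iic (hD'.2 t ht)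
  have hm : AEStronglyMeasurable (fun p : ℝ × Ω ↦ D p.1 p.2 - D' p.1 p.2)
      ((volume.restrict (Set.Ioc s T)).prod P) := hD.1.sub hD'.1
  have h0 : ∫⁻ p, ‖D p.1 p.2 - D' p.1 p.2‖ₑ ∂((volume.restrict (Set.Ioc s T)).prod P) = 0 := by
    rw [lintegral_prod _ hm.enorm, lintegral_eq_zero_of_ae_eq_zero]
    filter_upwards [h] with t ht
    refine lintegral_eq_zero_of_ae_eq_zero ?_
    filter_upwards [ht] with ω hω
    simp [hω]
  filter_upwards [(lintegral_eq_zero_iff' hm.enorm).1 h0] with p hp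
  exact sub_eq_zero.1 (enorm_eq_zero.1 hp)

end DR

/-! ### The two parts of the delayed integral -/

section DelayedIntegral

variable {Ω : Type*} [MeasurableSpace Ω] {B : ℝ → Ω → ℝ} {P : Measure Ω} [IsProbabilityMeasure P]
  {H s T : ℝ} {γ : ℝ → Ω → ℝ}

lemma memLp_of_lintegral_sq_lt_top
    (hγ : AEStronglyMeasurable (fun p : ℝ × Ω ↦ γ p.1 p.2)
      ((volume.restrict (Set.Icc s T)).prod P))
    (hγ_sq : ∫⁻ ω, (∫⁻ t in Set.Icc s T, ENNReal.ofReal (γ t ω ^ 2)) ∂P < ⊤) :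
    MemLp (fun p : ℝ × Ω ↦ γ p.1 p.2) 2 ((volume.restrict (Set.Icc s T)).prod P) := by
  refine (memLp_two_iff_lintegral hγ).2 ?_
  rw [lintegral_prod_symm _ (hγ.enorm.pow_const 2)]
  refine lt_of_le_of_lt (le_of_eq ?_) hγ_sq
  refine lintegral_congr fun ω ↦ lintegral_congr fun t ↦ ?_
  rw [Real.enorm_eq_ofReal_abs, ← ENNReal.ofReal_pow (abs_nonneg _), sq_abs]

lemma ae_ae_swap_of_ae_prod {α : Type*} [MeasurableSpace α] {μ : Measure α} [SFinite μ]
    {p : α × Ω → Prop} (h : ∀ᵐ z ∂(μ.prod P), p z) : ∀ᵐ ω ∂P, ∀ᵐ t ∂μ, p (t, ω) :=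
  Measure.ae_ae_of_ae_prod (p := fun z : Ω × α ↦ p z.swap)
    ((Measure.measurePreserving_swap (μ := P) (ν := μ)).quasiMeasurePreserving.ae h)

lemma ae_intervalIntegrable_fbmG (hH : 1 / 2 < H)
    (hγ : MemLp (fun p : ℝ × Ω ↦ γ p.1 p.2) 2 ((volume.restrict (Set.Icc s T)).prod P)) :
    ∀ᵐ ω ∂P, ∀ᵐ τ ∂(volume.restrict (Set.Icc s T)),
      IntervalIntegrable (fun t ↦ (t - τ) ^ (H - 3 / 2) * γ t ω) volume τ T := by
  have h1 := ae_integrable_fracKernel hH hγ.1.stronglyMeasurable_mk (hγ.ae_eq hγ.1.ae_eq_mk)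
  filter_upwards [ae_ae_swap_of_ae_prod h1, ae_ae_swap_of_ae_prod hγ.1.ae_eq_mk] with ω h2 h3
  filter_upwards [h2, ae_restrict_mem measurableSet_Icc] with τ h4 hτ
  refine intervalIntegrable_of_integrable_fracKernel hτ (h4.congr ?_)
  filter_upwards [h3] with t ht
  rw [← ht]

/-- The Itô integral `∫ γ dW_H` exists: `G_H` is square integrable and known at time `s`. -/
lemma exists_isIntegralDW (hB : IsTwoSidedBrownianMotion B P) (hH : 1 / 2 < H) (hsT : s ≤ T)
    (hγ : MemLp (fun p : ℝ × Ω ↦ γ p.1 p.2) 2 ((volume.restrict (Set.Icc s T)).prod P))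
    (hγ_past : ∀ t ∈ Set.Icc s T, Measurable[brownianPast B P s] (γ t)) :
    ∃ I, IsIntegralDW B P H s T γ I := by
  set γ' := hγ.1.mk _ with hγ'
  have hγ'm : StronglyMeasurable γ' := hγ.1.stronglyMeasurable_mk
  have hγ'2 : MemLp γ' 2 ((volume.restrict (Set.Icc s T)).prod P) := hγ.ae_eq hγ.1.ae_eq_mk
  have hG : (fun p : ℝ × Ω ↦ fbmG H T (fun t ↦ γ t p.2) p.1)
      =ᵐ[(volume.restrict (Set.Icc s T)).prod P] fun p ↦ fbmConst H * (H - 1 / 2) *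
        ∫ t in Set.Icc s T, fracKernel H (T - s) (t - p.1) * γ' (t, p.2) := by
    have h1 : ∀ᵐ p : ℝ × Ω ∂((volume.restrict (Set.Icc s T)).prod P), p.1 ∈ Set.Icc s T :=
      Measure.quasiMeasurePreserving_fst.ae (ae_restrict_mem measurableSet_Icc)
    have h2 := Measure.quasiMeasurePreserving_snd (μ := volume.restrict (Set.Icc s T)) |>.ae
      (ae_ae_swap_of_ae_prod hγ.1.ae_eq_mk)
    filter_upwards [h1, h2] with p hp1 hp2
    rw [fbmG_eq_integral_fracKernel hp1]
    congr 1
    refine integral_congr_ae ?_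
    filter_upwards [hp2] with t ht
    rw [ht]
  refine exists_isItoIntegral (𝒢₀ := brownianPast B P s) hB Set.ordConnected_Icc
    (Set.nonempty_Icc.2 hsT) (isExhaustedByIoc_Icc hsT) (fun u hu ↦ brownianPast_mono hu.1)
    (((memLp_fractionalIntegral hH hγ'm hγ'2).const_mul _).ae_eq hG.symm) ?_
  have hsec : ∀ᵐ t ∂(volume.restrict (Set.Icc s T)),
      AEStronglyMeasurable[brownianPast B P s] (fun ω ↦ γ' (t, ω)) P := by
    filter_upwards [Measure.ae_ae_of_ae_prod hγ.1.ae_eq_mk, ae_restrict_mem measurableSet_Icc]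
      with t ht htS
    exact (hγ_past t htS).stronglyMeasurable.aestronglyMeasurable.congr ht
  filter_upwards [Measure.ae_ae_of_ae_prod hG, ae_integrable_prod_fracKernel hH hγ'm hγ'2]
    with τ h1 h2
  have h3 := aestronglyMeasurable_integral_of_section (brownianPast_le hB s) h2 (by
    filter_upwards [hsec] with t ht
    exact ht.const_mul _)
  exact (h3.const_mul _).congr (Filter.EventuallyEq.symm h1)

lemma IsIntegralDW.memL1 (hB : IsTwoSidedBrownianMotion B P) {I : Ω → ℝ}
    (hI : IsIntegralDW B P H s T γ I) : MemL1 P (brownianPast B P T) I :=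
  ⟨IsItoIntegral.aestronglyMeasurable_past hB Set.Icc_subset_Iic_self hI,
    hI.2.1.mono_exponent (by norm_num)⟩

lemma IsDR.integrable_mul (hB : IsTwoSidedBrownianMotion B P) (hH : H ∈ Set.Ioo (1 / 2 : ℝ) 1)
    (hsT : s ≤ T)
    (hγ : MemLp (fun p : ℝ × Ω ↦ γ p.1 p.2) 2 ((volume.restrict (Set.Icc s T)).prod P))
    {D : ℝ → Ω → ℝ} (hD : IsDR B P H s T D) :
    Integrable (fun p : ℝ × Ω ↦ γ p.1 p.2 * D p.1 p.2)
      ((volume.restrict (Set.Icc s T)).prod P) := by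
  have h := hD.memLp hB hH hsT
  rw [Measure.restrict_congr_set Ioc_ae_eq_Icc] at h
  exact hγ.integrable_mul h

lemma IsDR.memL1_integral_mul (hB : IsTwoSidedBrownianMotion B P)
    (hH : H ∈ Set.Ioo (1 / 2 : ℝ) 1) (hsT : s ≤ T)
    (hγ : MemLp (fun p : ℝ × Ω ↦ γ p.1 p.2) 2 ((volume.restrict (Set.Icc s T)).prod P))
    (hγ_past : ∀ t ∈ Set.Icc s T, Measurable[brownianPast B P s] (γ t))
    {D : ℝ → Ω → ℝ} (hD : IsDR B P H s T D) :
    MemL1 P (brownianPast B P T) (fun ω ↦ ∫ t in s..T, γ t ω * D t ω) := by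
  have hint := hD.integrable_mul hB hH hsT hγ
  rw [← Measure.restrict_congr_set Ioc_ae_eq_Icc] at hint
  simp only [intervalIntegral.integral_of_le hsT]
  refine ⟨?_, memLp_one_iff_integrable.2 hint.integral_prod_right⟩
  refine (aestronglyMeasurable_integral_of_section (brownianPast_le hB s) hint ?_).mono
    (brownianPast_mono hsT)
  filter_upwards [hD.section_aestronglyMeasurable hB, ae_restrict_mem measurableSet_Ioc]
    with t h1 h2
  exact (hγ_past t (Set.Ioc_subset_Icc_self h2)).stronglyMeasurable.aestronglyMeasurable.mul h1

lemma IsDR.integral_mul_ae_eq (hB : IsTwoSidedBrownianMotion B P) (hsT : s ≤ T)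
    {D D' : ℝ → Ω → ℝ} (hD : IsDR B P H s T D) (hD' : IsDR B P H s T D') :
    (fun ω ↦ ∫ t in s..T, γ t ω * D t ω) =ᵐ[P] fun ω ↦ ∫ t in s..T, γ t ω * D' t ω := by
  filter_upwards [ae_ae_swap_of_ae_prod (hD.ae_eq hB hD')] with ω hω
  simp only [intervalIntegral.integral_of_le hsT]
  refine integral_congr_ae ?_
  filter_upwards [hω] with t ht
  rw [ht]

end DelayedIntegral

end

theorem corollary1 {Ω : Type*} [MeasurableSpace Ω] (P : Measure Ω) [IsProbabilityMeasure P]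
    (B : ℝ → Ω → ℝ) (hB : IsTwoSidedBrownianMotion B P)
    (H : ℝ) (hH : H ∈ Set.Ioo (1 / 2 : ℝ) 1) (s T : ℝ) (hsT : s < T)
    (γ : ℝ → Ω → ℝ)
    (hγ_joint : AEStronglyMeasurable (fun p : ℝ × Ω ↦ γ p.1 p.2)
      ((volume.restrict (Set.Icc s T)).prod P))
    (hγ_past : ∀ t ∈ Set.Icc s T, Measurable[brownianPast B P s] (γ t))
    (hγ_sq : ∫⁻ ω, (∫⁻ t in Set.Icc s T, ENNReal.ofReal (γ t ω ^ 2)) ∂P < ⊤) :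
    -- the Lebesgue integral defining `G_H(τ, s, T, γ)` converges
    (∀ᵐ ω ∂P, ∀ᵐ τ ∂(volume.restrict (Set.Icc s T)),
      IntervalIntegrable (fun t ↦ (t - τ) ^ (H - 3 / 2) * γ t ω) volume τ T) ∧
    -- the Itô integral `∫ γ dW_H = ∫ G_H(τ, s, T, γ) dB(τ)` exists, is unique and lies in `L₁`
    (∃ I : Ω → ℝ, IsIntegralDW B P H s T γ I ∧ MemL1 P (brownianPast B P T) I ∧
      ∀ I' : Ω → ℝ, IsIntegralDW B P H s T γ I' → I' =ᵐ[P] I) ∧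
    -- the process `𝒟R_H` exists, and the Lebesgue integral `∫ γ 𝒟R_H dt` converges and lies in `L₁`
    (∃ D : ℝ → Ω → ℝ, IsDR B P H s T D) ∧
    (∀ D : ℝ → Ω → ℝ, IsDR B P H s T D →
      Integrable (fun p : ℝ × Ω ↦ γ p.1 p.2 * D p.1 p.2) ((volume.restrict (Set.Icc s T)).prod P) ∧
      (∀ᵐ ω ∂P, IntervalIntegrable (fun t ↦ γ t ω * D t ω) volume s T) ∧
      MemL1 P (brownianPast B P T) (fun ω ↦ ∫ t in s..T, γ t ω * D t ω)) ∧
    -- the delayed integral is well defined, as one element of `L₁(Ω, 𝒢_T, P)`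
    (∃ J : Ω → ℝ, IsDelayedIntegral B P H s T γ J ∧ MemL1 P (brownianPast B P T) J ∧
      ∀ J' : Ω → ℝ, IsDelayedIntegral B P H s T γ J' → J' =ᵐ[P] J) := by
  have hγ := memLp_of_lintegral_sq_lt_top hγ_joint hγ_sq
  obtain ⟨I, hI⟩ := exists_isIntegralDW hB hH.1 hsT.le hγ hγ_past
  obtain ⟨D, hD⟩ := exists_isDR (s := s) (T := T) hB hH.2
  have hI_unique : ∀ I' : Ω → ℝ, IsIntegralDW B P H s T γ I' → I' =ᵐ[P] I := fun I' hI' ↦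
    IsItoIntegral.ae_eq hB Set.ordConnected_Icc hI' hI
  have hI1 := hI.memL1 hB
  have hD1 := hD.memL1_integral_mul hB hH hsT.le hγ hγ_past
  refine ⟨ae_intervalIntegrable_fbmG hH.1 hγ, ⟨I, hI, hI1, hI_unique⟩, ⟨D, hD⟩,
    fun D' hD' ↦ ?_, ⟨fun ω ↦ I ω + ∫ t in s..T, γ t ω * D t ω, ⟨I, D, hI, hD, .rfl⟩,
      ⟨hI1.1.add hD1.1, hI1.2.add hD1.2⟩, ?_⟩⟩
  · have hint := hD'.integrable_mul hB hH hsT.le hγ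
    refine ⟨hint, ?_, hD'.memL1_integral_mul hB hH hsT.le hγ hγ_past⟩
    filter_upwards [hint.prod_left_ae] with ω hω
    rw [intervalIntegrable_iff_integrableOn_Icc_of_le hsT.le]
    exact hω
  · rintro J' ⟨I', D', hI', hD', hJ'⟩
    filter_upwards [hJ', hI_unique I' hI', hD'.integral_mul_ae_eq (γ := γ) hB hsT.le hD]
      with ω h1 h2 h3
    rw [h1, h2, h3]
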